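/- Let $n\ge 2$, $0<s<1$, $1<p\le q<\infty$ and $0<\lambda\le\Lambda$. Then there is a constant $c_b=c_b(n,s,p,q,\lambda,\Lambda)>0$ with the following property. Let $g:[0,\infty)\to[0,\infty)$ be strictly increasing and continuous with $g(0)=0$, $\lim_{t\to\infty}g(t)=\infty$ and $$p\le \frac{t\,g(t)}{G(t)}\le q\quad\text{for all }t>0,\qquad G(t):=\int_0^t g(\tau)\,d\tau .$$ Let $K:\mathbb R^n\times\mathbb R^n\to(0,\infty]$ be measurable and symmetric with $\lambda|x-y|^{-n}\le K(x,y)\le\Lambda|x-y|^{-n}$ for all $x,y$. Let $\Omega\subset\mathbb R^n$ be a bounded domain and $C_\Omega:=(\Omega\times\mathbb R^n)\cup(\mathbb R^n\times\Omega)$. Let $\mathbb W^{s,G}(\Omega)$ be the set of measurable $v:\mathbb R^n\to\mathbb R$ with $$\int_\Omega G(|v|)\,dx<\infty\quad\text{and}\quad \iint_{C_\Omega}G\Big(\frac{|v(x)-v(y)|}{|x-y|^s}\Big)\frac{dx\,dy}{|x-y|^n}<\infty,$$ and let $L^g_s(\mathbb R^n)$ be the set of measurable $v:\mathbb R^n\to\mathbb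 R$ with $\int_{\mathbb R^n}g\big(\frac{|v(x)|}{(1+|x|)^s}\big)\frac{dx}{(1+|x|)^{n+s}}<\infty$. Put $$\mathrm{Tail}(v;x_0,R):=\int_{\mathbb R^n\setminus B_R(x_0)}g\Big(\frac{|v(x)|}{|x-x_0|^s}\Big)\frac{dx}{|x-x_0|^{n+s}} .$$ A function $u\in\mathbb W^{s,G}(\Omega)$ is called a weak solution (respectively, weak subsolution) if $$\iint_{C_\Omega}g\Big(\frac{|u(x)-u(y)|}{|x-y|^s}\Big)\frac{u(x)-u(y)}{|u(x)-u(y)|}\,(\eta(x)-\eta(y))\,K(x,y)\,\frac{dx\,dy}{|x-y|^s}=0\quad(\text{respectively }\le 0)$$ for every $\eta\in\mathbb W^{s,G}(\Omega)$ (respectively, every nonnegative $\eta\in\mathbb W^{s,G}(\Omega)$) with $\eta=0$ in $\mathbb R^n\setminus\Omega$, the integrand being read as $0$ where $u(x)=u(y)$. Let $u\in\mathbb W^{s,G}(\Omega)\cap L^g_s(\mathbb R^n)$, and write $u_+=\max\{u,0\}$. (i) If $u$ is a weak subsolution, then for every ball $B_r=B_r(x_0)$, $r>0$, with $\overline{B_r}\subset\Omega$,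 $$\operatorname*{ess\,sup}_{B_{r/2}(x_0)}u_+\le c_b\,r^sG^{-1}\Big(\frac1{|B_r|}\int_{B_r}G\Big(\frac{u_+}{r^s}\Big)dx\Big)+r^sg^{-1}\big(r^s\,\mathrm{Tail}(u_+;x_0,r/2)\big).$$ (ii) If $u$ is a weak solution, then $u\in L^\infty_{\mathrm{loc}}(\Omega)$, and for every ball $B_r=B_r(x_0)$, $r>0$, with $\overline{B_r}\subset\Omega$, $$\|u\|_{L^\infty(B_{r/2}(x_0))}\le c_b\,r^sG^{-1}\Big(\frac1{|B_r|}\int_{B_r}G\Big(\frac{|u|}{r^s}\Big)dx\Big)+r^sg^{-1}\big(r^s\,\mathrm{Tail}(u;x_0,r/2)\big).$$ -/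

import Mathlib

open MeasureTheory
open scoped ENNReal

noncomputable section

namespace FractionalOrlicz

/-- The space `ℝⁿ` with its Euclidean norm. -/
abbrev Eucl (n : ℕ) : Type := EuclideanSpace ℝ (Fin n)

/-- `G(t) = ∫₀ᵗ g(τ) dτ`, used for `t ≥ 0` only. -/
def primitive (g : ℝ → ℝ) (t : ℝ) : ℝ := ∫ τ in (0 : ℝ)..t, g τ

/-- The inverse of a bijection `f : [0,∞) → [0,∞)`. -/
def halfLineInv (f : ℝ → ℝ) (y : ℝ) : ℝ := Function.invFunOn f (Set.Ici 0) y

/-- The assumptions on `g : [0,∞) → [0,∞)`: it is strictly increasing and continuous, `g(0) = 0`,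
`g(t) → ∞` as `t → ∞`, and `p ≤ t g(t) / G(t) ≤ q` for `t > 0`. The values of `g` at negative
numbers play no role. -/
structure IsGrowthFunction (p q : ℝ) (g : ℝ → ℝ) : Prop where
  strictMonoOn : StrictMonoOn g (Set.Ici 0)
  continuousOn : ContinuousOn g (Set.Ici 0)
  map_zero : g 0 = 0
  tendsto_atTop : Filter.Tendsto g Filter.atTop Filter.atTop
  le_ratio : ∀ t, 0 < t → p ≤ t * g t / primitive g t
  ratio_le : ∀ t, 0 < t → t * g t / primitive g t ≤ q

/-- A symmetric, (Lebesgue) measurable kernel `K : ℝⁿ × ℝⁿ → (0,∞]` with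
`lam / |x - y|ⁿ ≤ K(x,y) ≤ Lam / |x - y|ⁿ`; the bounds are read in `[0,∞]`, so `K(x,x) = ∞`. -/
structure IsKernel {n : ℕ} (lam Lam : ℝ) (K : Eucl n → Eucl n → ℝ≥0∞) : Prop where
  aemeasurable : AEMeasurable (fun z : Eucl n × Eucl n => K z.1 z.2) volume
  pos : ∀ x y, 0 < K x y
  symm : ∀ x y, K x y = K y x
  lower : ∀ x y, ENNReal.ofReal lam / ‖x - y‖ₑ ^ n ≤ K x y
  upper : ∀ x y, K x y ≤ ENNReal.ofReal Lam / ‖x - y‖ₑ ^ n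

/-- `C_Ω = (Ω × ℝⁿ) ∪ (ℝⁿ × Ω)`. -/
def crossSet {n : ℕ} (Ω : Set (Eucl n)) : Set (Eucl n × Eucl n) :=
  (Ω ×ˢ Set.univ) ∪ (Set.univ ×ˢ Ω)

/-- Membership in the space `𝕎^{s,G}(Ω)`, where `G` is the primitive of `g`: `v` is (Lebesgue)
measurable on `ℝⁿ`, `∫_Ω G(|v|) dx < ∞`, and
`∬_{C_Ω} G(|v(x) - v(y)| / |x - y|^s) |x - y|^{-n} dx dy < ∞`. -/
structure MemW {n : ℕ} (s : ℝ) (g : ℝ → ℝ) (Ω : Set (Eucl n)) (v : Eucl n → ℝ) : Prop where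
  aemeasurable : AEMeasurable v volume
  modular_lt_top : ∫⁻ x in Ω, ENNReal.ofReal (primitive g |v x|) < ∞
  gagliardo_lt_top :
    ∫⁻ z in crossSet Ω,
      ENNReal.ofReal (primitive g (|v z.1 - v z.2| / ‖z.1 - z.2‖ ^ s) / ‖z.1 - z.2‖ ^ n) < ∞

/-- Membership in the tail space `L^g_s(ℝⁿ)`. -/
structure MemTailSpace {n : ℕ} (s : ℝ) (g : ℝ → ℝ) (v : Eucl n → ℝ) : Prop where
  aemeasurable : AEMeasurable v volume
  lintegral_lt_top :
    ∫⁻ x, ENNReal.ofReal (g (|v x| / (1 + ‖x‖) ^ s) / (1 + ‖x‖) ^ ((n : ℝ) + s)) < ∞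

/-- `Tail(v; x₀, R) = ∫_{ℝⁿ ∖ B_R(x₀)} g(|v(x)| / |x - x₀|^s) |x - x₀|^{-n-s} dx`. -/
def tail {n : ℕ} (s : ℝ) (g : ℝ → ℝ) (v : Eucl n → ℝ) (x₀ : Eucl n) (R : ℝ) : ℝ :=
  ∫ x in (Metric.ball x₀ R)ᶜ, g (|v x| / ‖x - x₀‖ ^ s) / ‖x - x₀‖ ^ ((n : ℝ) + s)

/-- The weak form of the operator, tested with `η`:
`∬_{C_Ω} g(|u(x)-u(y)| / |x-y|^s) (u(x)-u(y)) / |u(x)-u(y)| (η(x)-η(y)) K(x,y) |x-y|^{-s} dx dy`.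
Where `u(x) = u(y)` the integrand is `0`, because `g(0) = 0`. The diagonal, on which `K = ∞`, is a
null set. -/
def weakForm {n : ℕ} (s : ℝ) (g : ℝ → ℝ) (K : Eucl n → Eucl n → ℝ≥0∞) (Ω : Set (Eucl n))
    (u η : Eucl n → ℝ) : ℝ :=
  ∫ z in crossSet Ω,
    g (|u z.1 - u z.2| / ‖z.1 - z.2‖ ^ s) * ((u z.1 - u z.2) / |u z.1 - u z.2|) *
      (η z.1 - η z.2) * (K z.1 z.2).toReal / ‖z.1 - z.2‖ ^ s

/-- Weak solutions of `ℒ u = 0` in `Ω`. -/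
def IsWeakSolution {n : ℕ} (s : ℝ) (g : ℝ → ℝ) (K : Eucl n → Eucl n → ℝ≥0∞) (Ω : Set (Eucl n))
    (u : Eucl n → ℝ) : Prop :=
  MemW s g Ω u ∧
    ∀ η : Eucl n → ℝ, MemW s g Ω η → (∀ x ∉ Ω, η x = 0) → weakForm s g K Ω u η = 0

/-- Weak subsolutions of `ℒ u = 0` in `Ω`. -/
def IsWeakSubsolution {n : ℕ} (s : ℝ) (g : ℝ → ℝ) (K : Eucl n → Eucl n → ℝ≥0∞)
    (Ω : Set (Eucl n)) (u : Eucl n → ℝ) : Prop :=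
  MemW s g Ω u ∧
    ∀ η : Eucl n → ℝ, MemW s g Ω η → (∀ x, 0 ≤ η x) → (∀ x ∉ Ω, η x = 0) →
      weakForm s g K Ω u η ≤ 0

end FractionalOrlicz

end

/-! The proof is a De Giorgi iteration on the modulars `Y(R, l) = ∫_{B_R} G((u - l)_+ / r^s)`. Fix a
natural number `N ≥ q`. Two growth facts are used throughout: `G(ct) ≤ c^N G(t)` for `c ≥ 1`, from
the upper ratio bound, and `G(ct) ≤ c G(t)` for `0 ≤ c ≤ 1`, from the monotonicity of `g`.

Energy. Testing with `φ^(N+1) (u - l)_+`, for a cutoff `φ`, gives a Caccioppoli inequality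
(`IsWeakSubsolution.caccioppoli`): the energy of the truncation on a smaller ball is bounded by a
cutoff error, which is a multiple of a modular, plus `∫ (u - l)_+` times the tail of `u_+`. Let `k`
be the candidate upper bound, with the tail at most `g(k/r^s)/r^s`. If `l - h` is a definite
fraction of `k`, then on `{u > l}` the number `g(k/r^s)` is dominated by a multiple of `g((u -
h)_+/r^s)`, so the tail term is also a multiple of the modular at level `h`
(`IsWeakSubsolution.energy_le`).

Gain. An elementary nonlocal Faber–Krahn inequality (`IsGrowthFunction.faberKrahn`) takes the place
of a Sobolev embedding. If the support of `v` has at most half the measure of a ball of radius `ρ`,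
then at least half of every `B_ρ(x)` consists of zeros of `v`. The interaction of `x` with these
zeros alone controls `G(v(x)/r^s)`, with the small factor `(ρ/r)^s`.

Iteration. Chebyshev's inequality bounds the measure of `{u > l}` by the previous modular. With `ρ`
shrinking geometrically, an induction gives geometric decay of the modulars along radii decreasing
to `r/2` and levels increasing to `k`, provided that the initial modular is at most `ε G(k/r^s)
|B_r|` (`exists_levelModular_threshold`). Hence `u ≤ k` on `B_{r/2}`.

Conclusion. The level `k = r^s (ε⁻¹ G⁻¹(mean of G(u_+/r^s)) + g⁻¹(r^s Tail) + τ)` meets both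
requirements for every `τ > 0`; letting `τ → 0` gives (i). Since the tail requirement needs no
constant, the tail term has coefficient one. Part (ii) is (i) applied to `u` and `-u`. -/

namespace FractionalOrlicz

/-! ### Growth functions: doubling, inverses and Young-type inequalities -/

section Growth

variable {p q : ℝ} {g : ℝ → ℝ}

theorem primitive_zero (g : ℝ → ℝ) : primitive g 0 = 0 := by simp [primitive]

/-- Nothing is known about `g` on negative numbers. Continuity, differentiability and measurability
are therefore derived from the clamped function, which is continuous on all of `ℝ` and has the same
primitive on `[0,∞)`. -/
theorem IsGrowthFunction.continuous_clamp (hg : IsGrowthFunction p q g) :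
    Continuous fun t => g (max t 0) :=
  hg.continuousOn.comp_continuous (by fun_prop) fun t => le_max_right t 0

theorem IsGrowthFunction.mono (hg : IsGrowthFunction p q g) {a b : ℝ} (ha : 0 ≤ a) (hab : a ≤ b) :
    g a ≤ g b :=
  hg.strictMonoOn.monotoneOn ha (ha.trans hab) hab

theorem IsGrowthFunction.pos (hg : IsGrowthFunction p q g) {t : ℝ} (ht : 0 < t) : 0 < g t := by
  simpa [hg.map_zero] using hg.strictMonoOn Set.self_mem_Ici ht.le ht

theorem IsGrowthFunction.nonneg (hg : IsGrowthFunction p q g) {t : ℝ} (ht : 0 ≤ t) : 0 ≤ g t := by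
  simpa [hg.map_zero] using hg.mono le_rfl ht

theorem IsGrowthFunction.intervalIntegrable (hg : IsGrowthFunction p q g) {a b : ℝ} (ha : 0 ≤ a)
    (hb : 0 ≤ b) : IntervalIntegrable g volume a b :=
  (hg.continuousOn.mono fun _ hx => (le_min ha hb).trans hx.1).intervalIntegrable

theorem primitive_eq_clamp (g : ℝ → ℝ) {t : ℝ} (ht : 0 ≤ t) :
    primitive g t = ∫ τ in (0 : ℝ)..t, g (max τ 0) := by
  refine intervalIntegral.integral_congr fun τ hτ => ?_
  rw [Set.uIcc_of_le ht] at hτ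
  simp [max_eq_left hτ.1]

theorem IsGrowthFunction.hasDerivAt_primitive (hg : IsGrowthFunction p q g) {t : ℝ} (ht : 0 < t) :
    HasDerivAt (primitive g) (g t) t := by
  have h := (hg.continuous_clamp).integral_hasStrictDerivAt 0 t |>.hasDerivAt
  rw [max_eq_left ht.le] at h
  refine h.congr_of_eventuallyEq ?_
  filter_upwards [lt_mem_nhds ht] with x hx using primitive_eq_clamp g hx.le

theorem IsGrowthFunction.continuous_primitive_clamp (hg : IsGrowthFunction p q g) :
    Continuous fun t => primitive g (max t 0) := by
  have h : Continuous fun t => ∫ τ in (0 : ℝ)..t, g (max τ 0) :=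
    intervalIntegral.continuous_primitive (fun a b => hg.continuous_clamp.intervalIntegrable a b) 0
  have h' : (fun t => primitive g (max t 0)) = fun t => ∫ τ in (0 : ℝ)..(max t 0), g (max τ 0) := by
    ext t
    exact primitive_eq_clamp g (le_max_right t 0)
  rw [h']
  exact h.comp (by fun_prop)

theorem IsGrowthFunction.continuousOn_primitive (hg : IsGrowthFunction p q g) :
    ContinuousOn (primitive g) (Set.Ici 0) :=
  hg.continuous_primitive_clamp.continuousOn.congr fun t ht => by simp [max_eq_left ht.out]

theorem IsGrowthFunction.strictMonoOn_primitive (hg : IsGrowthFunction p q g) :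
    StrictMonoOn (primitive g) (Set.Ici 0) := by
  refine strictMonoOn_of_deriv_pos (convex_Ici 0) hg.continuousOn_primitive fun x hx => ?_
  rw [interior_Ici] at hx
  rw [(hg.hasDerivAt_primitive hx).deriv]
  exact hg.pos hx

theorem IsGrowthFunction.primitive_mono (hg : IsGrowthFunction p q g) {a b : ℝ} (ha : 0 ≤ a)
    (hab : a ≤ b) : primitive g a ≤ primitive g b :=
  hg.strictMonoOn_primitive.monotoneOn ha (ha.trans hab) hab

theorem IsGrowthFunction.primitive_pos (hg : IsGrowthFunction p q g) {t : ℝ} (ht : 0 < t) :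
    0 < primitive g t := by
  simpa [primitive_zero] using hg.strictMonoOn_primitive Set.self_mem_Ici ht.le ht

theorem IsGrowthFunction.primitive_nonneg (hg : IsGrowthFunction p q g) {t : ℝ} (ht : 0 ≤ t) :
    0 ≤ primitive g t := by
  simpa [primitive_zero] using hg.primitive_mono le_rfl ht

/-- The primitive is sublinear under shrinking of its argument. -/
theorem IsGrowthFunction.primitive_mul_le (hg : IsGrowthFunction p q g) {c t : ℝ} (hc : 0 ≤ c)
    (hc1 : c ≤ 1) (ht : 0 ≤ t) : primitive g (c * t) ≤ c * primitive g t := by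
  have h : primitive g (c * t) = c * ∫ τ in (0 : ℝ)..t, g (c * τ) := by
    simp [primitive, intervalIntegral.mul_integral_comp_mul_left]
  rw [h]
  refine mul_le_mul_of_nonneg_left ?_ hc
  refine intervalIntegral.integral_mono_on ht ?_ (hg.intervalIntegrable le_rfl ht) fun x hx =>
    hg.mono (mul_nonneg hc hx.1) (mul_le_of_le_one_left hx.1 hc1)
  refine (hg.continuousOn.comp (by fun_prop) fun x hx => ?_).intervalIntegrable
  rw [Set.uIcc_of_le ht] at hx
  exact mul_nonneg hc hx.1

theorem IsGrowthFunction.primitive_le_mul (hg : IsGrowthFunction p q g) {t : ℝ} (ht : 0 ≤ t) :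
    primitive g t ≤ t * g t := by
  have h := intervalIntegral.integral_mono_on ht (hg.intervalIntegrable le_rfl ht)
    (intervalIntegrable_const (c := g t)) fun x hx => hg.mono hx.1 hx.2
  simpa [primitive] using h

theorem IsGrowthFunction.mul_le_primitive (hg : IsGrowthFunction p q g) {N : ℕ} (hN : q ≤ N)
    {t : ℝ} (ht : 0 ≤ t) : t * g t ≤ N * primitive g t := by
  rcases ht.eq_or_lt with rfl | ht
  · simp [primitive_zero]
  · exact ((div_le_iff₀ (hg.primitive_pos ht)).1 (hg.ratio_le t ht)).trans
      (mul_le_mul_of_nonneg_right hN (hg.primitive_pos ht).le)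

/-- The quotient `G(ct) / c^N` is nonincreasing in `c`: the sign of its derivative is that of `ct
g(ct) - N G(ct)`, which is at most `0` because `N ≥ q`. -/
theorem IsGrowthFunction.primitive_mul_le_pow (hg : IsGrowthFunction p q g) {N : ℕ} (hN : q ≤ N)
    {c t : ℝ} (hc : 1 ≤ c) (ht : 0 ≤ t) : primitive g (c * t) ≤ c ^ N * primitive g t := by
  rcases ht.eq_or_lt with rfl | ht
  · simp [primitive_zero]
  have hd : ∀ x : ℝ, 0 < x → HasDerivAt (fun c => primitive g (c * t) / c ^ N)
      ((g (x * t) * t * x ^ N - primitive g (x * t) * (N * x ^ (N - 1))) / (x ^ N) ^ 2) x := by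
    intro x hx
    have h1 : HasDerivAt (fun c : ℝ => c * t) t x := by
      simpa using (hasDerivAt_id x).mul_const t
    have h2 := (hg.hasDerivAt_primitive (mul_pos hx ht)).comp x h1
    exact h2.div (hasDerivAt_pow N x) (by positivity)
  have hanti : AntitoneOn (fun c => primitive g (c * t) / c ^ N) (Set.Ici 1) := by
    refine antitoneOn_of_deriv_nonpos (convex_Ici 1) (fun x hx => ?_) (fun x hx => ?_)
      fun x hx => ?_
    · exact (hd x (lt_of_lt_of_le one_pos hx)).continuousAt.continuousWithinAt
    · rw [interior_Ici] at hx
      exact (hd x (one_pos.trans hx)).differentiableAt.differentiableWithinAt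
    · rw [interior_Ici] at hx
      have hx0 : 0 < x := one_pos.trans hx
      rw [(hd x hx0).deriv]
      refine div_nonpos_of_nonpos_of_nonneg ?_ (by positivity)
      have h := hg.mul_le_primitive hN (mul_pos hx0 ht).le
      rcases N with _ | k
      -- `N = 0` is impossible, since it would give `x t g(x t) ≤ 0`.
      · have := hg.pos (mul_pos hx0 ht)
        have := mul_pos (mul_pos hx0 ht) this
        simp at h
        linarith
      · have e : g (x * t) * t * x ^ (k + 1) - primitive g (x * t) * ((k + 1 : ℕ) * x ^ (k + 1 - 1))
            = x ^ k * (x * t * g (x * t) - (k + 1 : ℕ) * primitive g (x * t)) := by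
          simp only [Nat.add_sub_cancel]
          ring
        rw [e]
        exact mul_nonpos_of_nonneg_of_nonpos (by positivity) (by linarith)
  have h := hanti Set.self_mem_Ici hc hc
  simp only [one_pow, div_one, one_mul] at h
  rw [div_le_iff₀ (by positivity)] at h
  linarith

/-- Since `G(t) ≤ t g(t) ≤ N G(t)`, doubling passes from `G` to `g` at the cost of a factor `N`. -/
theorem IsGrowthFunction.map_mul_le_pow (hg : IsGrowthFunction p q g) {N : ℕ} (hN : q ≤ N)
    {c t : ℝ} (hc : 1 ≤ c) (ht : 0 ≤ t) : g (c * t) ≤ N * c ^ N * g t := by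
  rcases ht.eq_or_lt with rfl | ht
  · simp [hg.map_zero]
  have hct : t ≤ c * t := le_mul_of_one_le_left ht.le hc
  have h : t * g (c * t) ≤ t * (N * c ^ N * g t) :=
    calc t * g (c * t) ≤ c * t * g (c * t) :=
          mul_le_mul_of_nonneg_right hct (hg.nonneg (ht.le.trans hct))
      _ ≤ N * primitive g (c * t) := hg.mul_le_primitive hN (ht.le.trans hct)
      _ ≤ N * (c ^ N * primitive g t) := by gcongr; exact hg.primitive_mul_le_pow hN hc ht.le
      _ ≤ N * (c ^ N * (t * g t)) := by gcongr; exact hg.primitive_le_mul ht.le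
      _ = t * (N * c ^ N * g t) := by ring
  exact le_of_mul_le_mul_left h ht

theorem IsGrowthFunction.primitive_add_le (hg : IsGrowthFunction p q g) {N : ℕ} (hN : q ≤ N)
    {a b : ℝ} (ha : 0 ≤ a) (hb : 0 ≤ b) :
    primitive g (a + b) ≤ 2 ^ N * (primitive g a + primitive g b) := by
  have key : ∀ a b : ℝ, 0 ≤ b → b ≤ a → primitive g (a + b) ≤
      2 ^ N * (primitive g a + primitive g b) := fun a b hb hab =>
    calc primitive g (a + b) ≤ primitive g (2 * a) := hg.primitive_mono (by linarith) (by linarith)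
      _ ≤ 2 ^ N * primitive g a := hg.primitive_mul_le_pow hN one_le_two (by linarith)
      _ ≤ _ := by
        gcongr
        linarith [hg.primitive_nonneg hb]
  rcases le_total b a with h | h
  · exact key a b hb h
  · rw [add_comm a, add_comm (primitive g a)]
    exact key b a ha h

/-- A crude Young inequality: replacing the smaller of `a`, `b` by the larger leaves `t g(t) ≤ N
G(t)` at a single point, so no conjugate function is needed. -/
theorem IsGrowthFunction.map_mul_le_add (hg : IsGrowthFunction p q g) {N : ℕ} (hN : q ≤ N)
    {a b : ℝ} (ha : 0 ≤ a) (hb : 0 ≤ b) : g a * b ≤ N * (primitive g a + primitive g b) := by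
  have h1 := hg.primitive_nonneg ha
  have h2 := hg.primitive_nonneg hb
  rcases le_total a b with h | h
  · calc g a * b ≤ g b * b := mul_le_mul_of_nonneg_right (hg.mono ha h) hb
      _ = b * g b := mul_comm _ _
      _ ≤ N * primitive g b := hg.mul_le_primitive hN hb
      _ ≤ _ := by gcongr; linarith
  · calc g a * b ≤ g a * a := mul_le_mul_of_nonneg_left h (hg.nonneg ha)
      _ = a * g a := mul_comm _ _
      _ ≤ N * primitive g a := hg.mul_le_primitive hN ha
      _ ≤ _ := by gcongr; linarith

theorem IsGrowthFunction.tendsto_primitive (hg : IsGrowthFunction p q g) :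
    Filter.Tendsto (primitive g) Filter.atTop Filter.atTop := by
  have h1 := hg.primitive_pos one_pos
  refine Filter.tendsto_atTop_mono' _ ?_ (Filter.tendsto_id.const_mul_atTop h1)
  filter_upwards [Filter.eventually_ge_atTop 1] with t ht
  have ht0 : 0 < t := by linarith
  have h := hg.primitive_mul_le (c := t⁻¹) (t := t) (by positivity) (inv_le_one_of_one_le₀ ht) ht0.le
  rw [inv_mul_cancel₀ ht0.ne', inv_mul_eq_div, le_div_iff₀ ht0] at h
  exact h

/-- Growing the argument by a factor `c ≥ 1` grows the primitive at least by `c`. -/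
theorem IsGrowthFunction.mul_primitive_le (hg : IsGrowthFunction p q g) {c t : ℝ} (hc : 1 ≤ c)
    (ht : 0 ≤ t) : c * primitive g t ≤ primitive g (c * t) := by
  have hc0 : 0 < c := by linarith
  have h := hg.primitive_mul_le (c := c⁻¹) (t := c * t) (by positivity)
    (inv_le_one_of_one_le₀ hc) (by positivity)
  rwa [inv_mul_cancel_left₀ hc0.ne', inv_mul_eq_div, le_div_iff₀ hc0, mul_comm] at h

/-- Surjectivity onto `[0,∞)` makes `halfLineInv` a genuine right inverse there, rather than a
default choice. -/
theorem exists_halfLine_eq {f : ℝ → ℝ} (hc : ContinuousOn f (Set.Ici 0)) (h0 : f 0 = 0)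
    (hf : Filter.Tendsto f Filter.atTop Filter.atTop) {y : ℝ} (hy : 0 ≤ y) :
    ∃ t ∈ Set.Ici (0 : ℝ), f t = y := by
  obtain ⟨b, hb, hb0⟩ := ((hf.eventually_ge_atTop y).and (Filter.eventually_ge_atTop 0)).exists
  obtain ⟨t, ht, h⟩ := intermediate_value_Icc hb0 (hc.mono Set.Icc_subset_Ici_self)
    (show y ∈ Set.Icc (f 0) (f b) from ⟨by simpa [h0] using hy, hb⟩)
  exact ⟨t, ht.1, h⟩

theorem IsGrowthFunction.halfLineInv_nonneg (hg : IsGrowthFunction p q g) {y : ℝ} (hy : 0 ≤ y) :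
    0 ≤ halfLineInv g y :=
  Function.invFunOn_mem (exists_halfLine_eq hg.continuousOn hg.map_zero hg.tendsto_atTop hy)

theorem IsGrowthFunction.map_halfLineInv (hg : IsGrowthFunction p q g) {y : ℝ} (hy : 0 ≤ y) :
    g (halfLineInv g y) = y :=
  Function.invFunOn_eq (exists_halfLine_eq hg.continuousOn hg.map_zero hg.tendsto_atTop hy)

theorem IsGrowthFunction.halfLineInv_primitive_nonneg (hg : IsGrowthFunction p q g) {y : ℝ}
    (hy : 0 ≤ y) : 0 ≤ halfLineInv (primitive g) y :=
  Function.invFunOn_mem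
    (exists_halfLine_eq hg.continuousOn_primitive (primitive_zero g) hg.tendsto_primitive hy)

theorem IsGrowthFunction.primitive_halfLineInv (hg : IsGrowthFunction p q g) {y : ℝ}
    (hy : 0 ≤ y) : primitive g (halfLineInv (primitive g) y) = y :=
  Function.invFunOn_eq
    (exists_halfLine_eq hg.continuousOn_primitive (primitive_zero g) hg.tendsto_primitive hy)

theorem IsGrowthFunction.halfLineInv_mono (hg : IsGrowthFunction p q g) {y z : ℝ} (hy : 0 ≤ y)
    (hyz : y ≤ z) : halfLineInv g y ≤ halfLineInv g z := by
  refine (hg.strictMonoOn.le_iff_le (hg.halfLineInv_nonneg hy)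
    (hg.halfLineInv_nonneg (hy.trans hyz))).1 ?_
  rwa [hg.map_halfLineInv hy, hg.map_halfLineInv (hy.trans hyz)]

theorem IsGrowthFunction.halfLineInv_primitive_mono (hg : IsGrowthFunction p q g) {y z : ℝ}
    (hy : 0 ≤ y) (hyz : y ≤ z) : halfLineInv (primitive g) y ≤ halfLineInv (primitive g) z := by
  refine (hg.strictMonoOn_primitive.le_iff_le (hg.halfLineInv_primitive_nonneg hy)
    (hg.halfLineInv_primitive_nonneg (hy.trans hyz))).1 ?_
  rwa [hg.primitive_halfLineInv hy, hg.primitive_halfLineInv (hy.trans hyz)]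

theorem IsGrowthFunction.aemeasurable_comp (hg : IsGrowthFunction p q g) {α : Type*}
    [MeasurableSpace α] {μ : Measure α} {f : α → ℝ} (hf : AEMeasurable f μ) (h0 : ∀ x, 0 ≤ f x) :
    AEMeasurable (fun x => g (f x)) μ := by
  have h := hg.continuous_clamp.measurable.comp_aemeasurable hf
  refine h.congr (Filter.Eventually.of_forall fun x => ?_)
  simp [max_eq_left (h0 x)]

theorem IsGrowthFunction.aemeasurable_primitive_comp (hg : IsGrowthFunction p q g) {α : Type*}
    [MeasurableSpace α] {μ : Measure α} {f : α → ℝ} (hf : AEMeasurable f μ) (h0 : ∀ x, 0 ≤ f x) :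
    AEMeasurable (fun x => primitive g (f x)) μ := by
  have h := hg.continuous_primitive_clamp.measurable.comp_aemeasurable hf
  refine h.congr (Filter.Eventually.of_forall fun x => ?_)
  simp [max_eq_left (h0 x)]

/-- The algebraic core of the Caccioppoli inequality: testing with a truncation times a power
of a cutoff function, with the cutoff error absorbed by Young's inequality. -/
theorem IsGrowthFunction.cutoff_young (hg : IsGrowthFunction p q g) {N : ℕ} (hN : q ≤ N)
    {a b α β h : ℝ} (hb : 0 ≤ b) (hab : b ≤ a) (hα : 0 ≤ α) (hβ : 0 ≤ β)
    (hβ1 : β ≤ 1) (hh : 0 < h) :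
    max α β ^ (N + 1) * primitive g ((a - b) / h) / 2 -
        ((N + 1) * N ^ 2 * (2 * (N + 1)) ^ N) * primitive g (a * |α - β| / h) ≤
      g ((a - b) / h) * (α ^ (N + 1) * a - β ^ (N + 1) * b) / h := by
  set t := (a - b) / h with ht
  have ht0 : 0 ≤ t := div_nonneg (by linarith) hh.le
  have hgt := hg.nonneg ht0
  have hGt := hg.primitive_nonneg ht0
  have hGle := hg.primitive_le_mul ht0
  have hsub : a - b = t * h := by rw [ht]; field_simp
  have ha : 0 ≤ a := hb.trans hab
  have hτ0 : 0 ≤ a * |α - β| / h := by positivity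
  have hGτ := hg.primitive_nonneg hτ0
  set C : ℝ := (N + 1) * N ^ 2 * (2 * (N + 1)) ^ N with hC
  have hC0 : 0 ≤ C := by positivity
  rcases le_total β α with hαβ | hαβ
  -- When the larger value `a` carries the larger cutoff, the cutoff difference has the favourable
  -- sign and no error arises.
  · rw [max_eq_left hαβ]
    have h1 : β ^ (N + 1) ≤ α ^ (N + 1) := pow_le_pow_left₀ hβ hαβ _
    have h2 : α ^ (N + 1) * (t * h) ≤ α ^ (N + 1) * a - β ^ (N + 1) * b := by
      rw [← hsub]; nlinarith
    have h3 : g t * (α ^ (N + 1) * (t * h)) / h ≤ g t * (α ^ (N + 1) * a - β ^ (N + 1) * b) / h := by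
      gcongr
    have h4 : g t * (α ^ (N + 1) * (t * h)) / h = α ^ (N + 1) * (t * g t) := by
      field_simp
    have h5 : α ^ (N + 1) * primitive g t ≤ α ^ (N + 1) * (t * g t) := by gcongr
    have h6 : 0 ≤ α ^ (N + 1) * primitive g t := by positivity
    have h7 := mul_nonneg hC0 hGτ
    linarith
  · rw [max_eq_right hαβ]
    rcases hβ.eq_or_lt with rfl | hβ
    · have : α = 0 := le_antisymm hαβ hα
      subst this
      simp [primitive_zero]
    set τ := a * |α - β| / h with hτ
    have habs : |α - β| = β - α := by rw [abs_of_nonpos (by linarith)]; ring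
    -- Bernoulli's inequality for `α / β`.
    have hpow : β ^ (N + 1) - α ^ (N + 1) ≤ (N + 1) * β ^ N * (β - α) := by
      have := one_add_mul_le_pow (a := α / β - 1) (by
        have : 0 ≤ α / β := by positivity
        linarith) (N + 1)
      have e : 1 + (α / β - 1) = α / β := by ring
      rw [e, div_pow, le_div_iff₀ (by positivity)] at this
      have e2 : (1 + ((N + 1 : ℕ) : ℝ) * (α / β - 1)) * β ^ (N + 1)
          = β ^ (N + 1) - (N + 1) * β ^ N * (β - α) := by
        push_cast
        field_simp
        ring
      linarith
    have h1 : β ^ (N + 1) * (t * h) - (N + 1) * β ^ N * (β - α) * a ≤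
        α ^ (N + 1) * a - β ^ (N + 1) * b := by
      rw [← hsub]
      nlinarith [mul_le_mul_of_nonneg_right hpow ha]
    have h2 : g t * (β ^ (N + 1) * (t * h) - (N + 1) * β ^ N * (β - α) * a) / h ≤
        g t * (α ^ (N + 1) * a - β ^ (N + 1) * b) / h := by gcongr
    have h3 : g t * (β ^ (N + 1) * (t * h) - (N + 1) * β ^ N * (β - α) * a) / h =
        β ^ (N + 1) * (t * g t) - (N + 1) * β ^ N * (g t * τ) := by
      rw [hτ, habs]
      field_simp
    rw [h3] at h2
    have h5 : β ^ (N + 1) * primitive g t ≤ β ^ (N + 1) * (t * g t) := by gcongr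
    -- Either `τ` is so small that the error is at most half of the main term, or `t ≤ 2(N+1)β⁻¹ τ`
    -- and doubling replaces `g(t)` by `g(τ)`. The loss `β⁻ᴺ` in the second case is cancelled
    -- exactly by `βᴺ`, which is why the cutoff is raised to the power `N + 1`.
    rcases le_total ((N + 1) * τ) (β * t / 2) with hc | hc
    · have h4 : (N + 1) * β ^ N * (g t * τ) ≤ β ^ (N + 1) * (t * g t) / 2 :=
        calc (N + 1) * β ^ N * (g t * τ) = β ^ N * g t * ((N + 1) * τ) := by ring
          _ ≤ β ^ N * g t * (β * t / 2) := by gcongr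
          _ = _ := by ring
      have h7 := mul_nonneg hC0 hGτ
      linarith
    · have hc1 : 1 ≤ 2 * (N + 1) / β := by
        rw [one_le_div hβ]
        have : (0 : ℝ) ≤ N := by positivity
        linarith
      have ht1 : t ≤ 2 * (N + 1) / β * τ := by
        rw [div_mul_eq_mul_div, le_div_iff₀ hβ]
        linarith
      have h4 : (N + 1) * β ^ N * (g t * τ) ≤ C * primitive g τ :=
        calc (N + 1) * β ^ N * (g t * τ) ≤
              (N + 1) * β ^ N * ((N * (2 * (N + 1) / β) ^ N * g τ) * τ) := by
              gcongr
              exact (hg.mono ht0 ht1).trans (hg.map_mul_le_pow hN hc1 hτ0)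
          _ = (N + 1) * N * (2 * (N + 1)) ^ N * (τ * g τ) := by
              rw [div_pow]; field_simp
          _ ≤ (N + 1) * N * (2 * (N + 1)) ^ N * (N * primitive g τ) :=
              mul_le_mul_of_nonneg_left (hg.mul_le_primitive hN hτ0) (by positivity)
          _ = _ := by rw [hC]; ring
      have h6 : 0 ≤ β ^ (N + 1) * (t * g t) := by positivity
      linarith

end Growth

end FractionalOrlicz

namespace FractionalOrlicz

/-! ### Cutoff functions against the singular kernel -/

section Kernel

/-- The profile `min(t^{1-s}, t^{-s})` of a Lipschitz cutoff of unit scale divided by `t^s`. -/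
noncomputable def cutoffProfile (s t : ℝ) : ℝ := min (t ^ (1 - s)) (t ^ (-s))

theorem cutoffProfile_nonneg {s t : ℝ} (ht : 0 ≤ t) : 0 ≤ cutoffProfile s t :=
  le_min (by positivity) (by positivity)

theorem cutoffProfile_le_one {s t : ℝ} (hs0 : 0 < s) (hs1 : s < 1) (ht : 0 ≤ t) :
    cutoffProfile s t ≤ 1 := by
  rcases le_total t 1 with h | h
  · exact (min_le_left _ _).trans (Real.rpow_le_one ht h (by linarith))
  · exact (min_le_right _ _).trans (Real.rpow_le_one_of_one_le_of_nonpos h (by linarith))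

theorem measurable_cutoffProfile (s : ℝ) : Measurable (cutoffProfile s) := by
  unfold cutoffProfile; fun_prop

/-- The total mass of the cutoff profile against the singular kernel `|z|^{-n}`. -/
noncomputable def cutoffMass (n : ℕ) (s : ℝ) : ℝ≥0∞ :=
  ∫⁻ z : Eucl n, ENNReal.ofReal (cutoffProfile s ‖z‖ / ‖z‖ ^ n)

/-- In polar coordinates the radial density is `t^(-s)` on `(0,1)`, integrable because `s < 1`, and
`t^(-s-1)` on `(1,∞)`, integrable because `s > 0`. -/
theorem cutoffMass_lt_top {n : ℕ} (hn : 1 ≤ n) {s : ℝ} (hs0 : 0 < s) (hs1 : s < 1) :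
    cutoffMass n s < ∞ := by
  have : Nontrivial (Eucl n) := Module.nontrivial_of_finrank_pos (R := ℝ) (by simp; omega)
  have h : Integrable (fun z : Eucl n => cutoffProfile s ‖z‖ / ‖z‖ ^ n) volume := by
    refine (integrable_fun_norm_addHaar volume (f := fun t => cutoffProfile s t / t ^ n)).2 ?_
    simp only [finrank_euclideanSpace, Fintype.card_fin, smul_eq_mul]
    have hm : Measurable fun y : ℝ => y ^ (n - 1) * (cutoffProfile s y / y ^ n) := by
      have := measurable_cutoffProfile s
      fun_prop
    have key : ∀ y : ℝ, 0 < y → ‖y ^ (n - 1) * (cutoffProfile s y / y ^ n)‖ =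
        cutoffProfile s y / y := by
      intro y hy
      have h0 := cutoffProfile_nonneg (s := s) hy.le
      rw [Real.norm_of_nonneg (by positivity)]
      obtain ⟨k, rfl⟩ : ∃ k, n = k + 1 := ⟨n - 1, by omega⟩
      simp only [Nat.add_sub_cancel]
      field_simp
      ring
    rw [← Set.Ioc_union_Ioi_eq_Ioi (zero_le_one' ℝ)]
    refine IntegrableOn.union ?_ ?_
    · rw [integrableOn_Ioc_iff_integrableOn_Ioo]
      refine Integrable.mono' ((intervalIntegral.integrableOn_Ioo_rpow_iff (s := -s) one_pos).2
        (by linarith)) hm.aestronglyMeasurable ?_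
      filter_upwards [ae_restrict_mem measurableSet_Ioo] with y hy
      rw [key y hy.1, div_le_iff₀ hy.1, ← Real.rpow_add_one hy.1.ne']
      exact (min_le_left _ _).trans_eq (by ring_nf)
    · refine Integrable.mono' ((integrableOn_Ioi_rpow_iff (s := -s - 1) one_pos).2
        (by linarith)) hm.aestronglyMeasurable ?_
      filter_upwards [ae_restrict_mem measurableSet_Ioi] with y hy
      have hy0 : 0 < y := one_pos.trans hy
      rw [key y hy0, div_le_iff₀ hy0, ← Real.rpow_add_one hy0.ne']
      exact (min_le_right _ _).trans_eq (by ring_nf)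
  refine (lintegral_mono fun z => ?_).trans_lt h.2
  exact Real.ofReal_le_enorm _

/-- The measure `|z|^(-n) dz` is invariant under dilations, so the mass depends on neither the scale
nor the centre. -/
theorem lintegral_cutoffProfile_scale {n : ℕ} {s r : ℝ} (hr : 0 < r) (x : Eucl n) :
    ∫⁻ y, ENNReal.ofReal (cutoffProfile s (‖x - y‖ / r) / ‖x - y‖ ^ n) = cutoffMass n s := by
  rw [lintegral_sub_left_eq_self
    (fun z : Eucl n => ENNReal.ofReal (cutoffProfile s (‖z‖ / r) / ‖z‖ ^ n)) x]
  have hm : Measurable fun z : Eucl n => ENNReal.ofReal (cutoffProfile s ‖z‖ / ‖z‖ ^ n) := by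
    have := measurable_cutoffProfile s
    fun_prop
  have h := lintegral_map (μ := (volume : Measure (Eucl n))) hm (measurable_const_smul r⁻¹)
  rw [Measure.map_addHaar_smul _ (inv_ne_zero hr.ne'), lintegral_smul_measure] at h
  simp only [finrank_euclideanSpace, Fintype.card_fin] at h
  have e1 : |((r⁻¹ ^ n)⁻¹ : ℝ)| = r ^ n := by
    rw [inv_pow, inv_inv, abs_of_pos (by positivity)]
  rw [e1] at h
  have e2 : ∀ z : Eucl n, ENNReal.ofReal (cutoffProfile s ‖r⁻¹ • z‖ / ‖r⁻¹ • z‖ ^ n) =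
      ENNReal.ofReal (r ^ n) * ENNReal.ofReal (cutoffProfile s (‖z‖ / r) / ‖z‖ ^ n) := by
    intro z
    rw [← ENNReal.ofReal_mul (by positivity), norm_smul, Real.norm_of_nonneg (by positivity),
      inv_mul_eq_div, div_pow]
    congr 1
    field_simp
  simp only [e2] at h
  rw [lintegral_const_mul' _ _ ENNReal.ofReal_ne_top, smul_eq_mul] at h
  have hr0 : ENNReal.ofReal (r ^ n) ≠ 0 := by simpa using pow_pos hr n
  exact ((ENNReal.mul_right_inj hr0 ENNReal.ofReal_ne_top).1 h).symm

variable {p q : ℝ} {g : ℝ → ℝ}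

/-- With `t = |x - y| / r`, the bounds `L|x - y|` and `1` on the cutoff difference give at most `L
r` times the profile after division by `t^s`. The factor `L r ≥ 1` leaves `G` by doubling, and the
profile, being at most `1`, leaves it linearly. -/
theorem IsGrowthFunction.primitive_cutoff_le (hg : IsGrowthFunction p q g) {N : ℕ} (hN : q ≤ N)
    {n : ℕ} {s r L a : ℝ} (hs0 : 0 < s) (hs1 : s < 1) (hr : 0 < r) (hLr : 1 ≤ L * r) (ha : 0 ≤ a)
    {φ : Eucl n → ℝ} (hφ : ∀ x y, |φ x - φ y| ≤ L * ‖x - y‖) (hφ1 : ∀ x y, |φ x - φ y| ≤ 1)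
    (x y : Eucl n) :
    primitive g (a * |φ x - φ y| / ‖x - y‖ ^ s) ≤
      (L * r) ^ N * primitive g (a / r ^ s) * cutoffProfile s (‖x - y‖ / r) := by
  have hG := hg.primitive_nonneg (t := a / r ^ s) (by positivity)
  have hc0 := cutoffProfile_nonneg (s := s) (t := ‖x - y‖ / r) (by positivity)
  rcases eq_or_ne x y with rfl | hxy
  · simp only [sub_self, abs_zero, mul_zero, zero_div, primitive_zero]
    simp only [sub_self] at hc0
    have : 0 ≤ L * r := by linarith
    exact mul_nonneg (mul_nonneg (pow_nonneg this _) hG) hc0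
  have hd : 0 < ‖x - y‖ := norm_pos_iff.2 (sub_ne_zero.2 hxy)
  have hLr0 : 0 < L * r := by linarith
  set t := ‖x - y‖ / r with ht
  have ht0 : 0 < t := by positivity
  have hdt : ‖x - y‖ = t * r := by rw [ht]; field_simp
  have hb : |φ x - φ y| * t ^ (-s) ≤ L * r * cutoffProfile s t := by
    rw [cutoffProfile, mul_min_of_nonneg _ _ hLr0.le]
    refine le_min ?_ ?_
    · rw [show 1 - s = 1 + -s by ring, Real.rpow_add ht0, Real.rpow_one, ← mul_assoc]
      gcongr
      refine (hφ x y).trans_eq ?_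
      rw [hdt]; ring
    · gcongr
      exact (hφ1 x y).trans hLr
  have he : a * |φ x - φ y| / ‖x - y‖ ^ s = (|φ x - φ y| * t ^ (-s)) * (a / r ^ s) := by
    rw [hdt, Real.mul_rpow ht0.le hr.le, Real.rpow_neg ht0.le]
    field_simp
  calc primitive g (a * |φ x - φ y| / ‖x - y‖ ^ s)
      ≤ primitive g (L * r * (cutoffProfile s t * (a / r ^ s))) := by
        rw [he, ← mul_assoc]
        refine hg.primitive_mono (by positivity) ?_
        gcongr
    _ ≤ (L * r) ^ N * primitive g (cutoffProfile s t * (a / r ^ s)) :=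
        hg.primitive_mul_le_pow hN hLr (by positivity)
    _ ≤ (L * r) ^ N * (cutoffProfile s t * primitive g (a / r ^ s)) := by
        gcongr
        exact hg.primitive_mul_le hc0 (cutoffProfile_le_one hs0 hs1 ht0.le) (by positivity)
    _ = _ := by ring

theorem IsGrowthFunction.lintegral_cutoff_le (hg : IsGrowthFunction p q g) {N : ℕ} (hN : q ≤ N)
    {n : ℕ} {s r L a : ℝ} (hs0 : 0 < s) (hs1 : s < 1) (hr : 0 < r) (hLr : 1 ≤ L * r) (ha : 0 ≤ a)
    {φ : Eucl n → ℝ} (hφ : ∀ x y, |φ x - φ y| ≤ L * ‖x - y‖) (hφ1 : ∀ x y, |φ x - φ y| ≤ 1)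
    (x : Eucl n) :
    ∫⁻ y, ENNReal.ofReal (primitive g (a * |φ x - φ y| / ‖x - y‖ ^ s) / ‖x - y‖ ^ n) ≤
      ENNReal.ofReal ((L * r) ^ N * primitive g (a / r ^ s)) * cutoffMass n s := by
  have hG := hg.primitive_nonneg (t := a / r ^ s) (by positivity)
  rw [← lintegral_cutoffProfile_scale hr x, ← lintegral_const_mul' _ _ ENNReal.ofReal_ne_top]
  refine lintegral_mono fun y => ?_
  rw [← ENNReal.ofReal_mul (by positivity), ← mul_div_assoc]
  refine ENNReal.ofReal_le_ofReal ?_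
  gcongr
  exact hg.primitive_cutoff_le hN hs0 hs1 hr hLr ha hφ hφ1 x y

end Kernel

end FractionalOrlicz

namespace FractionalOrlicz

/-! ### Double integrals over product sets -/

section Product

variable {n : ℕ}

theorem aemeasurable_fst {f : Eucl n → ℝ} (hf : AEMeasurable f volume) :
    AEMeasurable (fun z : Eucl n × Eucl n => f z.1) volume :=
  hf.comp_quasiMeasurePreserving Measure.quasiMeasurePreserving_fst

theorem aemeasurable_snd {f : Eucl n → ℝ} (hf : AEMeasurable f volume) :
    AEMeasurable (fun z : Eucl n × Eucl n => f z.2) volume :=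
  hf.comp_quasiMeasurePreserving Measure.quasiMeasurePreserving_snd

theorem setLIntegral_swap (A B : Set (Eucl n)) (f : Eucl n × Eucl n → ℝ≥0∞) :
    ∫⁻ z in A ×ˢ B, f z = ∫⁻ z in B ×ˢ A, f z.swap := by
  have h : MeasurePreserving (Prod.swap : Eucl n × Eucl n → Eucl n × Eucl n) volume volume :=
    Measure.measurePreserving_swap
  have := h.setLIntegral_comp_preimage_emb MeasurableEquiv.prodComm.measurableEmbedding f (A ×ˢ B)
  rw [← this, Set.preimage_swap_prod]

theorem setLIntegral_prod_eq (A B : Set (Eucl n)) {f : Eucl n × Eucl n → ℝ≥0∞}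
    (hf : AEMeasurable f volume) :
    ∫⁻ z in A ×ˢ B, f z = ∫⁻ x in A, ∫⁻ y in B, f (x, y) := by
  rw [Measure.volume_eq_prod, ← Measure.prod_restrict, lintegral_prod]
  rw [Measure.prod_restrict]
  exact hf.restrict

variable {p q : ℝ} {g : ℝ → ℝ}

theorem IsGrowthFunction.aemeasurable_energy (hg : IsGrowthFunction p q g) {s : ℝ}
    {f : Eucl n × Eucl n → ℝ} (hf : AEMeasurable f volume) (h0 : ∀ z, 0 ≤ f z) :
    AEMeasurable (fun z : Eucl n × Eucl n =>
      ENNReal.ofReal (primitive g (f z / ‖z.1 - z.2‖ ^ s) / ‖z.1 - z.2‖ ^ n)) volume := by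
  have h1 : AEMeasurable (fun z : Eucl n × Eucl n => f z / ‖z.1 - z.2‖ ^ s) volume :=
    hf.div (by fun_prop)
  have h2 := hg.aemeasurable_primitive_comp h1 fun z => by have := h0 z; positivity
  exact (h2.div (by fun_prop)).ennreal_ofReal

/-- Integrating out the second variable turns the cutoff error into a single modular; the scale
enters the constant only through `L r`. -/
theorem IsGrowthFunction.setLIntegral_cutoff_le (hg : IsGrowthFunction p q g) {N : ℕ} (hN : q ≤ N)
    {s r L : ℝ} (hs0 : 0 < s) (hs1 : s < 1) (hr : 0 < r) (hLr : 1 ≤ L * r)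
    {φ w : Eucl n → ℝ} (hφ : ∀ x y, |φ x - φ y| ≤ L * ‖x - y‖) (hφ1 : ∀ x y, |φ x - φ y| ≤ 1)
    (hφm : AEMeasurable φ volume) (hw : AEMeasurable w volume) (hw0 : ∀ x, 0 ≤ w x)
    (A B : Set (Eucl n)) :
    ∫⁻ z in A ×ˢ B, ENNReal.ofReal
        (primitive g (w z.1 * |φ z.1 - φ z.2| / ‖z.1 - z.2‖ ^ s) / ‖z.1 - z.2‖ ^ n) ≤
      ENNReal.ofReal ((L * r) ^ N) * cutoffMass n s *
        ∫⁻ x in A, ENNReal.ofReal (primitive g (w x / r ^ s)) := by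
  have hm : AEMeasurable (fun z : Eucl n × Eucl n => w z.1 * |φ z.1 - φ z.2|) volume :=
    (aemeasurable_fst hw).mul (continuous_abs.measurable.comp_aemeasurable
      ((aemeasurable_fst hφm).sub (aemeasurable_snd hφm)))
  rw [setLIntegral_prod_eq A B (hg.aemeasurable_energy hm fun z =>
    mul_nonneg (hw0 _) (abs_nonneg _))]
  have hG : AEMeasurable (fun x => ENNReal.ofReal (primitive g (w x / r ^ s)))
      (volume.restrict A) :=
    (hg.aemeasurable_primitive_comp (hw.div_const _) fun x => by
      have := hw0 x; positivity).ennreal_ofReal.restrict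
  rw [← lintegral_const_mul'' _ hG]
  refine lintegral_mono fun x => ?_
  refine (setLIntegral_le_lintegral _ _).trans
    ((hg.lintegral_cutoff_le hN hs0 hs1 hr hLr (hw0 x) hφ hφ1 x).trans_eq ?_)
  have : 0 ≤ L * r := by linarith
  rw [ENNReal.ofReal_mul (by positivity)]
  ring

end Product

/-! ### Admissibility of cutoffs times truncations as test functions -/

section TestFunction

variable {n : ℕ} {p q : ℝ} {g : ℝ → ℝ}

theorem abs_pow_sub_pow_le {α β : ℝ} (hα : 0 ≤ α) (hα1 : α ≤ 1) (hβ : 0 ≤ β) (hβ1 : β ≤ 1)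
    (m : ℕ) : |α ^ m - β ^ m| ≤ m * |α - β| := by
  induction m with
  | zero => simp
  | succ k ih =>
    have e : α ^ (k + 1) - β ^ (k + 1) = α * (α ^ k - β ^ k) + β ^ k * (α - β) := by ring
    rw [e]
    refine (abs_add_le _ _).trans ?_
    rw [abs_mul, abs_mul, abs_of_nonneg hα, abs_of_nonneg (pow_nonneg hβ k)]
    have h1 : α * |α ^ k - β ^ k| ≤ 1 * (k * |α - β|) := by gcongr
    have h2 : β ^ k * |α - β| ≤ 1 * |α - β| := by
      gcongr; exact pow_le_one₀ hβ hβ1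
    push_cast
    linarith

/-- The truncation `(u - k)_+`. -/
def trunc (u : Eucl n → ℝ) (k : ℝ) (x : Eucl n) : ℝ := max (u x - k) 0

theorem trunc_nonneg (u : Eucl n → ℝ) (k : ℝ) (x : Eucl n) : 0 ≤ trunc u k x := le_max_right _ _

theorem trunc_le_abs (u : Eucl n → ℝ) {k : ℝ} (hk : 0 ≤ k) (x : Eucl n) : trunc u k x ≤ |u x| :=
  max_le (by linarith [le_abs_self (u x)]) (abs_nonneg _)

theorem abs_trunc_sub_le (u : Eucl n → ℝ) (k : ℝ) (x y : Eucl n) :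
    |trunc u k x - trunc u k y| ≤ |u x - u y| := by
  have := abs_max_sub_max_le_abs (u x - k) (u y - k) 0
  simpa [trunc] using this

theorem aemeasurable_trunc {u : Eucl n → ℝ} (hu : AEMeasurable u volume) (k : ℝ) :
    AEMeasurable (trunc u k) volume :=
  (hu.sub_const k).max aemeasurable_const

/-- By the discrete product rule, the difference of `φ w` is at most `|u(x) - u(y)| + w(x)|φ(x) -
φ(y)|`. The first part has finite energy by assumption, the second by the cutoff estimate. -/
theorem MemW.mul_trunc (hg : IsGrowthFunction p q g) {N : ℕ} (hN : q ≤ N)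
    {s L k : ℝ} (hn : 1 ≤ n) (hs0 : 0 < s) (hs1 : s < 1) {Ω : Set (Eucl n)} {u : Eucl n → ℝ}
    (hu : MemW s g Ω u) (hk : 0 ≤ k) {φ : Eucl n → ℝ} (hL : 1 ≤ L)
    (hφ : ∀ x y, |φ x - φ y| ≤ L * ‖x - y‖) (hφ0 : ∀ x, 0 ≤ φ x) (hφ1 : ∀ x, φ x ≤ 1)
    (hφm : AEMeasurable φ volume) :
    MemW s g Ω fun x => φ x * trunc u k x := by
  have hw := aemeasurable_trunc hu.aemeasurable k
  have hη := hφm.mul hw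
  have hle : ∀ x, |φ x * trunc u k x| ≤ |u x| := fun x => by
    rw [abs_of_nonneg (mul_nonneg (hφ0 x) (trunc_nonneg _ _ _))]
    exact (mul_le_of_le_one_left (trunc_nonneg _ _ _) (hφ1 x)).trans (trunc_le_abs u hk x)
  have hφd : ∀ x y, |φ x - φ y| ≤ 1 := fun x y =>
    abs_le.2 ⟨by linarith [hφ0 x, hφ1 y], by linarith [hφ0 y, hφ1 x]⟩
  refine ⟨hη, (lintegral_mono fun x => ?_).trans_lt hu.modular_lt_top, ?_⟩
  · exact ENNReal.ofReal_le_ofReal (hg.primitive_mono (abs_nonneg _) (hle x))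
  set f : Eucl n × Eucl n → ℝ≥0∞ := fun z => ENNReal.ofReal (primitive g
    (|φ z.1 * trunc u k z.1 - φ z.2 * trunc u k z.2| / ‖z.1 - z.2‖ ^ s) / ‖z.1 - z.2‖ ^ n) with hf
  have hfs : ∀ z, f z.swap = f z := fun z => by
    simp only [hf, Prod.fst_swap, Prod.snd_swap]
    rw [abs_sub_comm, norm_sub_rev]
  have key : ∫⁻ z in Ω ×ˢ Set.univ, f z < ∞ := by
    set e : Eucl n × Eucl n → ℝ≥0∞ := fun z => ENNReal.ofReal
      (primitive g (|u z.1 - u z.2| / ‖z.1 - z.2‖ ^ s) / ‖z.1 - z.2‖ ^ n) with he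
    set c : Eucl n × Eucl n → ℝ≥0∞ := fun z => ENNReal.ofReal (primitive g
      (trunc u k z.1 * |φ z.1 - φ z.2| / ‖z.1 - z.2‖ ^ s) / ‖z.1 - z.2‖ ^ n) with hc
    have hem : AEMeasurable e volume := hg.aemeasurable_energy
      (continuous_abs.measurable.comp_aemeasurable
        ((aemeasurable_fst hu.aemeasurable).sub (aemeasurable_snd hu.aemeasurable)))
      fun z => abs_nonneg _
    have hpt : ∀ z, f z ≤ ENNReal.ofReal (2 ^ N) * (e z + c z) := by
      intro z
      have h0 := trunc_nonneg u k z.1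
      have hA : 0 ≤ |u z.1 - u z.2| / ‖z.1 - z.2‖ ^ s := by positivity
      have hB : 0 ≤ trunc u k z.1 * |φ z.1 - φ z.2| / ‖z.1 - z.2‖ ^ s := by positivity
      have hGA := hg.primitive_nonneg hA
      have hGB := hg.primitive_nonneg hB
      simp only [hf, he, hc]
      rw [← ENNReal.ofReal_add (by positivity) (by positivity),
        ← ENNReal.ofReal_mul (by positivity)]
      refine ENNReal.ofReal_le_ofReal ?_
      rw [← add_div, ← mul_div_assoc]
      gcongr
      refine le_trans (hg.primitive_mono (by positivity) ?_) (hg.primitive_add_le hN hA hB)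
      rw [← add_div]
      gcongr
      have e1 : φ z.1 * trunc u k z.1 - φ z.2 * trunc u k z.2 =
          φ z.2 * (trunc u k z.1 - trunc u k z.2) + trunc u k z.1 * (φ z.1 - φ z.2) := by ring
      rw [e1]
      refine (abs_add_le _ _).trans ?_
      rw [abs_mul, abs_mul, abs_of_nonneg h0, abs_of_nonneg (hφ0 z.2)]
      gcongr
      exact (mul_le_of_le_one_left (abs_nonneg _) (hφ1 _)).trans (abs_trunc_sub_le _ _ _ _)
    refine (lintegral_mono hpt).trans_lt ?_
    rw [lintegral_const_mul' _ _ ENNReal.ofReal_ne_top, lintegral_add_left' hem.restrict]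
    refine ENNReal.mul_lt_top ENNReal.ofReal_lt_top (ENNReal.add_lt_top.2 ⟨?_, ?_⟩)
    · exact (lintegral_mono_set Set.subset_union_left).trans_lt hu.gagliardo_lt_top
    -- Only finiteness matters here, so the cutoff estimate is used at the unit scale `r = 1`.
    · refine (hg.setLIntegral_cutoff_le hN hs0 hs1 one_pos (by simpa using hL) hφ hφd hφm hw
        (trunc_nonneg u k) Ω Set.univ).trans_lt ?_
      refine ENNReal.mul_lt_top
        (ENNReal.mul_lt_top ENNReal.ofReal_lt_top (cutoffMass_lt_top hn hs0 hs1)) ?_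
      refine (lintegral_mono fun x => ?_).trans_lt hu.modular_lt_top
      rw [Real.one_rpow, div_one]
      exact ENNReal.ofReal_le_ofReal
        (hg.primitive_mono (trunc_nonneg _ _ _) (trunc_le_abs u hk x))
  calc ∫⁻ z in crossSet Ω, f z ≤ (∫⁻ z in Ω ×ˢ Set.univ, f z) + ∫⁻ z in Set.univ ×ˢ Ω, f z :=
        lintegral_union_le _ _ _
    _ < ∞ := by
        rw [setLIntegral_swap Set.univ Ω]
        simp only [hfs]
        exact ENNReal.add_lt_top.2 ⟨key, key⟩

end TestFunction

/-! ### The kernel bounds and the integrability of the weak form -/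

section WeakForm

variable {n : ℕ} {p q lam Lam : ℝ} {g : ℝ → ℝ} {K : Eucl n → Eucl n → ℝ≥0∞}

theorem IsKernel.eq_top (hK : IsKernel lam Lam K) (hlam : 0 < lam) (hn : 1 ≤ n) (x : Eucl n) :
    K x x = ∞ := by
  have h := hK.lower x x
  simpa [show n ≠ 0 by omega, ENNReal.div_zero, hlam] using h

theorem IsKernel.toReal_bounds (hK : IsKernel lam Lam K) (hlam : 0 < lam) (hLam : lam ≤ Lam)
    (hn : 1 ≤ n) (x y : Eucl n) :
    lam / ‖x - y‖ ^ n ≤ (K x y).toReal ∧ (K x y).toReal ≤ Lam / ‖x - y‖ ^ n := by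
  rcases eq_or_ne x y with rfl | hxy
  -- On the diagonal `K = ∞` has `toReal` equal to `0`, and both bounds are `0` as well because
  -- division by `0` gives `0`.
  · simp [hK.eq_top hlam hn, show n ≠ 0 by omega]
  have hd : 0 < ‖x - y‖ := norm_pos_iff.2 (sub_ne_zero.2 hxy)
  have e : ∀ c : ℝ, ENNReal.ofReal c / ‖x - y‖ₑ ^ n = ENNReal.ofReal (c / ‖x - y‖ ^ n) := by
    intro c
    rw [ENNReal.ofReal_div_of_pos (by positivity), ← ofReal_norm,
      ENNReal.ofReal_pow hd.le]
  have h1 := hK.lower x y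
  have h2 := hK.upper x y
  rw [e] at h1 h2
  have hLam0 : 0 < Lam := hlam.trans_le hLam
  refine ⟨?_, ENNReal.toReal_le_of_le_ofReal (by positivity) h2⟩
  exact (ENNReal.ofReal_le_iff_le_toReal (h2.trans_lt ENNReal.ofReal_lt_top).ne).1 h1

/-- The integrand of the weak form. -/
noncomputable def weakIntegrand (s : ℝ) (g : ℝ → ℝ) (K : Eucl n → Eucl n → ℝ≥0∞)
    (u η : Eucl n → ℝ) (x y : Eucl n) : ℝ :=
  g (|u x - u y| / ‖x - y‖ ^ s) * ((u x - u y) / |u x - u y|) *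
      (η x - η y) * (K x y).toReal / ‖x - y‖ ^ s

theorem weakIntegrand_swap (hK : IsKernel lam Lam K) (s : ℝ) (g : ℝ → ℝ)
    (u η : Eucl n → ℝ) (x y : Eucl n) :
    weakIntegrand s g K u η y x = weakIntegrand s g K u η x y := by
  unfold weakIntegrand
  rw [abs_sub_comm (u y), norm_sub_rev y, hK.symm y x]
  ring

/-- The crude Young inequality bounds the integrand by the energy densities of `u` and `η`.
Integrability ensures that the sign of `weakForm` carries information, since a non-integrable
integrand would have integral `0` by convention. -/
theorem integrableOn_weakIntegrand (hg : IsGrowthFunction p q g) {N : ℕ} (hN : q ≤ N)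
    (hK : IsKernel lam Lam K) (hlam : 0 < lam) (hLam : lam ≤ Lam) (hn : 1 ≤ n) {s : ℝ}
    {Ω : Set (Eucl n)} {u η : Eucl n → ℝ} (hu : MemW s g Ω u) (hη : MemW s g Ω η) :
    IntegrableOn (fun z : Eucl n × Eucl n => weakIntegrand s g K u η z.1 z.2) (crossSet Ω) := by
  have hum := (aemeasurable_fst hu.aemeasurable).sub (aemeasurable_snd hu.aemeasurable)
  have hηm := (aemeasurable_fst hη.aemeasurable).sub (aemeasurable_snd hη.aemeasurable)
  have habs : AEMeasurable (fun z : Eucl n × Eucl n => |u z.1 - u z.2|) volume :=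
    continuous_abs.measurable.comp_aemeasurable hum
  have hm : AEMeasurable (fun z : Eucl n × Eucl n => weakIntegrand s g K u η z.1 z.2) volume := by
    have hnorm : AEMeasurable (fun z : Eucl n × Eucl n => ‖z.1 - z.2‖ ^ s) volume := by fun_prop
    have h1 := hg.aemeasurable_comp (habs.div hnorm) fun z => by
      simp only [Pi.div_apply]; positivity
    exact (((h1.mul (hum.div habs)).mul hηm).mul hK.aemeasurable.ennreal_toReal).div hnorm
  refine ⟨hm.aestronglyMeasurable.restrict, ?_⟩
  have hLam0 : 0 < Lam := hlam.trans_le hLam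
  set e : (Eucl n → ℝ) → Eucl n × Eucl n → ℝ≥0∞ := fun v z => ENNReal.ofReal
      (primitive g (|v z.1 - v z.2| / ‖z.1 - z.2‖ ^ s) / ‖z.1 - z.2‖ ^ n) with he
  have hem : AEMeasurable (e u) volume := hg.aemeasurable_energy habs fun z => abs_nonneg _
  have hpt : ∀ z : Eucl n × Eucl n, ‖weakIntegrand s g K u η z.1 z.2‖ₑ ≤
      ENNReal.ofReal (Lam * N) * (e u z + e η z) := by
    rintro ⟨x, y⟩
    have hA : 0 ≤ |u x - u y| / ‖x - y‖ ^ s := by positivity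
    have hB : 0 ≤ |η x - η y| / ‖x - y‖ ^ s := by positivity
    have hGA := hg.primitive_nonneg hA
    have hGB := hg.primitive_nonneg hB
    have hgA := hg.nonneg hA
    simp only [he]
    rw [← ENNReal.ofReal_add (by positivity) (by positivity),
      ← ENNReal.ofReal_mul (by positivity), ← ofReal_norm]
    refine ENNReal.ofReal_le_ofReal ?_
    have hsgn : abs ((u x - u y) / |u x - u y|) ≤ 1 := by
      rw [abs_div, abs_abs]; exact div_self_le_one _
    calc ‖weakIntegrand s g K u η x y‖
        = g (|u x - u y| / ‖x - y‖ ^ s) * abs ((u x - u y) / |u x - u y|) * (|η x - η y| / ‖x - y‖ ^ s)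
            * (K x y).toReal := by
          rw [weakIntegrand, Real.norm_eq_abs, abs_div, abs_mul, abs_mul, abs_mul,
            abs_of_nonneg hgA, abs_of_nonneg (ENNReal.toReal_nonneg),
            abs_of_nonneg (Real.rpow_nonneg (norm_nonneg _) s)]
          ring
      _ ≤ g (|u x - u y| / ‖x - y‖ ^ s) * 1 * (|η x - η y| / ‖x - y‖ ^ s)
            * (Lam / ‖x - y‖ ^ n) := by
          gcongr
          exact (hK.toReal_bounds hlam hLam hn x y).2
      _ = g (|u x - u y| / ‖x - y‖ ^ s) * (|η x - η y| / ‖x - y‖ ^ s) * (Lam / ‖x - y‖ ^ n) := by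
          ring
      _ ≤ (N * (primitive g (|u x - u y| / ‖x - y‖ ^ s) +
            primitive g (|η x - η y| / ‖x - y‖ ^ s))) * (Lam / ‖x - y‖ ^ n) := by
          exact mul_le_mul_of_nonneg_right (hg.map_mul_le_add hN hA hB) (by positivity)
      _ = _ := by ring
  refine (lintegral_mono hpt).trans_lt ?_
  rw [lintegral_const_mul' _ _ ENNReal.ofReal_ne_top, lintegral_add_left' hem.restrict]
  exact ENNReal.mul_lt_top ENNReal.ofReal_lt_top
    (ENNReal.add_lt_top.2 ⟨hu.gagliardo_lt_top, hη.gagliardo_lt_top⟩)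

end WeakForm

end FractionalOrlicz

namespace FractionalOrlicz

/-! ### Pointwise lower bounds for the tested integrand -/

section Caccioppoli

variable {n : ℕ} {p q lam Lam : ℝ} {g : ℝ → ℝ} {K : Eucl n → Eucl n → ℝ≥0∞}

/-- The constant in front of the cutoff error in the local energy estimate. -/
def youngConst (N : ℕ) : ℝ := (N + 1) * N ^ 2 * (2 * (N + 1)) ^ N

theorem youngConst_nonneg (N : ℕ) : 0 ≤ youngConst N := by unfold youngConst; positivity

/-- This is the near-diagonal estimate: `cutoff_young` applied to the truncations, multiplied by the
kernel bounds. The error is symmetrized in `x` and `y` so that `u(y) ≤ u(x)` may be assumed. -/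
theorem weakIntegrand_lower (hg : IsGrowthFunction p q g) {N : ℕ} (hN : q ≤ N)
    (hK : IsKernel lam Lam K) (hlam : 0 < lam) (hLam : lam ≤ Lam) (hn : 1 ≤ n) (s k : ℝ)
    (u : Eucl n → ℝ) {φ : Eucl n → ℝ} (hφ0 : ∀ x, 0 ≤ φ x) (hφ1 : ∀ x, φ x ≤ 1) (x y : Eucl n) :
    lam / 2 * (max (φ x) (φ y) ^ (N + 1) *
        (primitive g (|trunc u k x - trunc u k y| / ‖x - y‖ ^ s) / ‖x - y‖ ^ n)) ≤
      weakIntegrand s g K u (fun x => φ x ^ (N + 1) * trunc u k x) x y +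
        Lam * youngConst N *
          (primitive g (trunc u k x * |φ x - φ y| / ‖x - y‖ ^ s) / ‖x - y‖ ^ n +
           primitive g (trunc u k y * |φ y - φ x| / ‖y - x‖ ^ s) / ‖y - x‖ ^ n) := by
  have hLam0 : 0 < Lam := hlam.trans_le hLam
  have hE : ∀ x y : Eucl n,
      0 ≤ primitive g (trunc u k x * |φ x - φ y| / ‖x - y‖ ^ s) / ‖x - y‖ ^ n := fun x y =>
    div_nonneg (hg.primitive_nonneg (by have := trunc_nonneg u k x; positivity)) (by positivity)
  have hY := youngConst_nonneg N
  wlog huxy : u y ≤ u x generalizing x y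
  · have h := this y x (not_le.1 huxy).le
    rw [weakIntegrand_swap hK, max_comm, abs_sub_comm (trunc u k y), norm_sub_rev y x,
      add_comm (primitive g _ / _)] at h
    rw [norm_sub_rev y x]
    exact h
  rcases huxy.eq_or_lt with heq | hlt
  · have hw : trunc u k x = trunc u k y := by simp [trunc, heq]
    have h1 := hE x y
    have h2 := hE y x
    simp only [hw, sub_self, abs_zero, zero_div, primitive_zero, mul_zero, weakIntegrand, heq,
      zero_mul, zero_add] at h1 h2 ⊢
    positivity
  set a := trunc u k x with ha
  set b := trunc u k y with hb
  have hb0 : 0 ≤ b := trunc_nonneg u k y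
  have hab : b ≤ a := max_le_max (by linarith) le_rfl
  have hD : a - b ≤ u x - u y := by
    have := abs_trunc_sub_le u k x y
    rw [abs_of_nonneg (by linarith), abs_of_nonneg (by linarith)] at this
    exact this
  have hxy : x ≠ y := fun h => by simp [h] at hlt
  have hd : 0 < ‖x - y‖ := norm_pos_iff.2 (sub_ne_zero.2 hxy)
  set h := ‖x - y‖ ^ s with hh
  have hh0 : 0 < h := by positivity
  have hY0 := hg.cutoff_young hN hb0 hab (hφ0 x) (hφ0 y) (hφ1 y) hh0
  set X := φ x ^ (N + 1) * a - φ y ^ (N + 1) * b with hX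
  -- Truncation only shrinks the difference, which is harmless when `X ≥ 0`. If `X < 0` then `b >
  -- 0`, so both values exceed `k` and the two differences coincide.
  have hgX : g ((a - b) / h) * X ≤ g ((u x - u y) / h) * X := by
    rcases le_or_gt 0 X with h0 | h0
    · gcongr
      exact hg.mono (div_nonneg (by linarith) hh0.le) (by gcongr)
    · have hbpos : 0 < b := by
        by_contra hcon
        have hb' : b = 0 := le_antisymm (not_lt.1 hcon) hb0
        have := mul_nonneg (pow_nonneg (hφ0 x) (N + 1)) (hb0.trans hab)
        rw [hX, hb'] at h0
        linarith
      have hky : 0 < u y - k := by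
        by_contra hcon
        rw [hb, trunc, max_eq_right (not_lt.1 hcon)] at hbpos
        exact lt_irrefl _ hbpos
      have : a - b = u x - u y := by
        rw [ha, hb, trunc, trunc, max_eq_left hky.le, max_eq_left (by linarith)]
        ring
      rw [this]
  have hgX' : g ((a - b) / h) * X / h ≤ g ((u x - u y) / h) * X / h := by gcongr
  have hI : weakIntegrand s g K u (fun x => φ x ^ (N + 1) * trunc u k x) x y =
      g ((u x - u y) / h) * X / h * (K x y).toReal := by
    have hpos : 0 < u x - u y := by linarith
    simp only [weakIntegrand]
    rw [abs_of_pos hpos, div_self hpos.ne']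
    ring
  obtain ⟨hK1, hK2⟩ := hK.toReal_bounds hlam hLam hn x y
  have hP0 : 0 ≤ max (φ x) (φ y) ^ (N + 1) * primitive g ((a - b) / h) :=
    mul_nonneg (pow_nonneg (le_max_of_le_left (hφ0 x)) _)
      (hg.primitive_nonneg (div_nonneg (by linarith) hh0.le))
  have hE0 : 0 ≤ primitive g (a * |φ x - φ y| / h) :=
    hg.primitive_nonneg (by have := hb0.trans hab; positivity)
  have hKnn : 0 ≤ (K x y).toReal := ENNReal.toReal_nonneg
  rw [hI, abs_of_nonneg (by linarith : 0 ≤ a - b)]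
  have h3 := mul_le_mul_of_nonneg_right (hY0.trans hgX') hKnn
  have h4 : lam / ‖x - y‖ ^ n * (max (φ x) (φ y) ^ (N + 1) * primitive g ((a - b) / h) / 2) ≤
      (K x y).toReal * (max (φ x) (φ y) ^ (N + 1) * primitive g ((a - b) / h) / 2) := by gcongr
  have h5 : (K x y).toReal * (youngConst N * primitive g (a * |φ x - φ y| / h)) ≤
      Lam / ‖x - y‖ ^ n * (youngConst N * primitive g (a * |φ x - φ y| / h)) := by gcongr
  have h6 : 0 ≤ Lam * youngConst N *
      (primitive g (b * |φ y - φ x| / ‖y - x‖ ^ s) / ‖y - x‖ ^ n) :=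
    mul_nonneg (by positivity) (hE y x)
  have e1 : lam / 2 * (max (φ x) (φ y) ^ (N + 1) * (primitive g ((a - b) / h) / ‖x - y‖ ^ n)) =
      lam / ‖x - y‖ ^ n * (max (φ x) (φ y) ^ (N + 1) * primitive g ((a - b) / h) / 2) := by ring
  have e2 : Lam * youngConst N * (primitive g (a * |φ x - φ y| / h) / ‖x - y‖ ^ n) =
      Lam / ‖x - y‖ ^ n * (youngConst N * primitive g (a * |φ x - φ y| / h)) := by ring
  rw [e1, mul_add, e2]
  have e3 : (max (φ x) (φ y) ^ (N + 1) * primitive g ((a - b) / h) / 2 -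
      (N + 1) * N ^ 2 * (2 * (N + 1)) ^ N * primitive g (a * |φ x - φ y| / h)) * (K x y).toReal =
      (K x y).toReal * (max (φ x) (φ y) ^ (N + 1) * primitive g ((a - b) / h) / 2) -
      (K x y).toReal * (youngConst N * primitive g (a * |φ x - φ y| / h)) := by
    rw [youngConst]; ring
  rw [e3] at h3
  linarith

/-- This handles interactions with points `y` off the support of `φ`. In the constant, `M^N` comes
from doubling of `g`, `M^n` from the kernel, and the last `M` from `M^s ≤ M` in the factor `|x -
y|^(-s)`. -/
theorem weakIntegrand_lower_far (hg : IsGrowthFunction p q g) {N : ℕ} (hN : q ≤ N)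
    (hK : IsKernel lam Lam K) (hlam : 0 < lam) (hLam : lam ≤ Lam) (hn : 1 ≤ n) {s k M : ℝ}
    (hs0 : 0 < s) (hs1 : s < 1) (hk : 0 ≤ k) (u : Eucl n → ℝ) {φ : Eucl n → ℝ}
    (hφ0 : ∀ x, 0 ≤ φ x) (hφ1 : ∀ x, φ x ≤ 1) {x₀ x y : Eucl n} (hy : φ y = 0)
    (hM : 1 ≤ M) (hyx : 0 < ‖y - x₀‖) (hfar : φ x ≠ 0 → ‖y - x₀‖ ≤ M * ‖x - y‖) :
    0 ≤ weakIntegrand s g K u (fun x => φ x ^ (N + 1) * trunc u k x) x y +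
      Lam * (N * M ^ (N + n + 1)) *
        (trunc u k x * (g (|max (u y) 0| / ‖y - x₀‖ ^ s) / ‖y - x₀‖ ^ ((n : ℝ) + s))) := by
  have hLam0 : 0 < Lam := hlam.trans_le hLam
  have hw0 := trunc_nonneg u k x
  have hgy : 0 ≤ g (|max (u y) 0| / ‖y - x₀‖ ^ s) := hg.nonneg (by positivity)
  have hM0 : 0 < M := by linarith
  have hrest : 0 ≤ Lam * (N * M ^ (N + n + 1)) *
      (trunc u k x * (g (|max (u y) 0| / ‖y - x₀‖ ^ s) / ‖y - x₀‖ ^ ((n : ℝ) + s))) := by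
    positivity
  have hη0 : 0 ≤ φ x ^ (N + 1) * trunc u k x := mul_nonneg (pow_nonneg (hφ0 x) _) hw0
  have hKnn : 0 ≤ (K x y).toReal := ENNReal.toReal_nonneg
  simp only [weakIntegrand, hy, ne_eq, Nat.add_eq_zero_iff, one_ne_zero, and_false,
    not_false_eq_true, zero_pow, zero_mul, sub_zero]
  have hgD : 0 ≤ g (|u x - u y| / ‖x - y‖ ^ s) := hg.nonneg (by positivity)
  -- Only `u(y) > u(x)` gives a negative contribution. There, if the test function is nonzero, `u(x)
  -- > k ≥ 0` and hence `u(y) - u(x) ≤ u_+(y)`.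
  rcases le_or_gt (u y) (u x) with hle | hlt
  · have : 0 ≤ (u x - u y) / |u x - u y| := div_nonneg (by linarith) (abs_nonneg _)
    positivity
  by_cases hz : φ x ^ (N + 1) * trunc u k x = 0
  · rw [hz]; simpa using hrest
  have hφx : φ x ≠ 0 := fun h => hz (by simp [h])
  have hwx : trunc u k x ≠ 0 := fun h => hz (by simp [h])
  have hkx : k < u x := by
    by_contra hcon
    exact hwx (by rw [trunc, max_eq_right (by linarith)])
  have hxy : 0 < ‖x - y‖ := by
    by_contra hcon
    have := hfar hφx
    have h0 : ‖x - y‖ = 0 := le_antisymm (not_lt.1 hcon) (norm_nonneg _)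
    rw [h0, mul_zero] at this
    linarith
  have hsgn : (u x - u y) / |u x - u y| = -1 := by
    rw [abs_of_neg (by linarith), div_neg, div_self (by linarith)]
  rw [hsgn]
  have hMs : M ^ s ≤ M := Real.rpow_le_self_of_one_le hM hs1.le
  have hs1' : ‖y - x₀‖ ^ s ≤ M * ‖x - y‖ ^ s :=
    calc ‖y - x₀‖ ^ s ≤ (M * ‖x - y‖) ^ s := by
          gcongr; exact hfar hφx
      _ = M ^ s * ‖x - y‖ ^ s := Real.mul_rpow hM0.le hxy.le
      _ ≤ _ := by gcongr
  have hn1 : ‖y - x₀‖ ^ n ≤ M ^ n * ‖x - y‖ ^ n := by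
    rw [← mul_pow]; gcongr; exact hfar hφx
  have hg1 : g (|u x - u y| / ‖x - y‖ ^ s) ≤ N * M ^ N * g (|max (u y) 0| / ‖y - x₀‖ ^ s) := by
    refine le_trans (hg.mono (by positivity) ?_) (hg.map_mul_le_pow hN hM (by positivity))
    have h1 : |u x - u y| ≤ |max (u y) 0| := by
      rw [abs_of_neg (by linarith), abs_of_nonneg (le_max_right _ _), max_eq_left (by linarith)]
      linarith
    rw [← mul_div_assoc, div_le_div_iff₀ (by positivity) (by positivity)]
    calc |u x - u y| * ‖y - x₀‖ ^ s ≤ |max (u y) 0| * (M * ‖x - y‖ ^ s) := by gcongr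
      _ = _ := by ring
  have hk1 : (K x y).toReal / ‖x - y‖ ^ s ≤ Lam * M ^ (n + 1) / ‖y - x₀‖ ^ ((n : ℝ) + s) := by
    rw [Real.rpow_add hyx, Real.rpow_natCast]
    refine (div_le_div_of_nonneg_right (hK.toReal_bounds hlam hLam hn x y).2
      (by positivity)).trans ?_
    rw [div_div, div_le_div_iff₀ (by positivity) (by positivity)]
    calc Lam * (‖y - x₀‖ ^ n * ‖y - x₀‖ ^ s) ≤
        Lam * ((M ^ n * ‖x - y‖ ^ n) * (M * ‖x - y‖ ^ s)) := by gcongr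
      _ = _ := by ring
  have hηw : φ x ^ (N + 1) * trunc u k x ≤ trunc u k x :=
    mul_le_of_le_one_left hw0 (pow_le_one₀ (hφ0 x) (hφ1 x))
  have key : g (|u x - u y| / ‖x - y‖ ^ s) * (φ x ^ (N + 1) * trunc u k x) *
      ((K x y).toReal / ‖x - y‖ ^ s) ≤
      (N * M ^ N * g (|max (u y) 0| / ‖y - x₀‖ ^ s)) * trunc u k x *
        (Lam * M ^ (n + 1) / ‖y - x₀‖ ^ ((n : ℝ) + s)) := by gcongr
  have e : (N * M ^ N * g (|max (u y) 0| / ‖y - x₀‖ ^ s)) * trunc u k x *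
        (Lam * M ^ (n + 1) / ‖y - x₀‖ ^ ((n : ℝ) + s)) =
      Lam * (N * M ^ (N + n + 1)) *
      (trunc u k x * (g (|max (u y) 0| / ‖y - x₀‖ ^ s) / ‖y - x₀‖ ^ ((n : ℝ) + s))) := by
    rw [add_assoc, pow_add M N]; ring
  rw [e] at key
  have e' : g (|u x - u y| / ‖x - y‖ ^ s) * -1 * (φ x ^ (N + 1) * trunc u k x) *
      (K x y).toReal / ‖x - y‖ ^ s = -(g (|u x - u y| / ‖x - y‖ ^ s) *
      (φ x ^ (N + 1) * trunc u k x) * ((K x y).toReal / ‖x - y‖ ^ s)) := by ring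
  rw [e']
  linarith

/-- The signed inequality `P ≤ I + Q` is split into positive and negative parts of `I`, so that `P`
and `Q` may take the value `∞` and need not be measurable. The hypothesis gives `∫ I⁺ ≤ ∫ I⁻ < ∞`,
and `∫ I⁻` is cancelled. -/
theorem lintegral_le_of_integral_nonpos {α : Type*} [MeasurableSpace α] {μ : Measure α}
    {I : α → ℝ} {P Q : α → ℝ≥0∞} (hI : Integrable I μ) (h0 : ∫ x, I x ∂μ ≤ 0)
    (h : ∀ x, P x + ENNReal.ofReal (-I x) ≤ ENNReal.ofReal (I x) + Q x) :
    ∫⁻ x, P x ∂μ ≤ ∫⁻ x, Q x ∂μ := by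
  have h1 : ∫⁻ x, ENNReal.ofReal (I x) ∂μ ≤ ∫⁻ x, ENNReal.ofReal (-I x) ∂μ := by
    rw [integral_eq_lintegral_pos_part_sub_lintegral_neg_part hI] at h0
    refine (ENNReal.toReal_le_toReal ?_ ?_).1 (by linarith)
    · exact hI.lintegral_lt_top.ne
    · exact hI.neg.lintegral_lt_top.ne
  have h2 := lintegral_mono (μ := μ) h
  have hm : AEMeasurable (fun x => ENNReal.ofReal (-I x)) μ :=
    hI.neg.aemeasurable.ennreal_ofReal
  rw [lintegral_add_right' _ hm,
    lintegral_add_left' hI.aemeasurable.ennreal_ofReal] at h2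
  have h3 : (∫⁻ x, P x ∂μ) + ∫⁻ x, ENNReal.ofReal (-I x) ∂μ ≤
      (∫⁻ x, Q x ∂μ) + ∫⁻ x, ENNReal.ofReal (-I x) ∂μ := by
    refine h2.trans ?_
    rw [add_comm]
    gcongr
  exact (ENNReal.add_le_add_iff_right hI.neg.lintegral_lt_top.ne).1 h3

theorem ofReal_add_ofReal_neg_le {c i ν : ℝ} (hc : 0 ≤ c) (hν : 0 ≤ ν) (h : c ≤ i + ν) :
    ENNReal.ofReal c + ENNReal.ofReal (-i) ≤ ENNReal.ofReal i + ENNReal.ofReal ν := by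
  rcases le_total 0 i with hi | hi
  · rw [ENNReal.ofReal_of_nonpos (by linarith : -i ≤ 0), add_zero, ← ENNReal.ofReal_add hi hν]
    exact ENNReal.ofReal_le_ofReal h
  · rw [ENNReal.ofReal_of_nonpos hi, zero_add, ← ENNReal.ofReal_add hc (by linarith)]
    exact ENNReal.ofReal_le_ofReal (by linarith)

end Caccioppoli

end FractionalOrlicz

namespace FractionalOrlicz

/-! ### The Caccioppoli inequality -/

section Energy

variable {n : ℕ} {p q lam Lam : ℝ} {g : ℝ → ℝ} {K : Eucl n → Eucl n → ℝ≥0∞}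

/-- The integrand of the tail of `v` at `x₀`. -/
noncomputable def tailDensity (s : ℝ) (g : ℝ → ℝ) (v : Eucl n → ℝ) (x₀ x : Eucl n) : ℝ :=
  g (|v x| / ‖x - x₀‖ ^ s) / ‖x - x₀‖ ^ ((n : ℝ) + s)

theorem IsGrowthFunction.tailDensity_nonneg (hg : IsGrowthFunction p q g) (s : ℝ)
    (v : Eucl n → ℝ) (x₀ x : Eucl n) : 0 ≤ tailDensity s g v x₀ x :=
  div_nonneg (hg.nonneg (by positivity)) (by positivity)

theorem IsGrowthFunction.aemeasurable_tailDensity (hg : IsGrowthFunction p q g) (s : ℝ)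
    {v : Eucl n → ℝ} (hv : AEMeasurable v volume) (x₀ : Eucl n) :
    AEMeasurable (tailDensity s g v x₀) volume := by
  have h1 : AEMeasurable (fun x => |v x| / ‖x - x₀‖ ^ s) volume :=
    (continuous_abs.measurable.comp_aemeasurable hv).div (by fun_prop)
  exact (hg.aemeasurable_comp h1 fun x => by positivity).div (by fun_prop)

/-- The local energy density of a function. -/
noncomputable def energyDensity (s : ℝ) (g : ℝ → ℝ) (w : Eucl n → ℝ) (z : Eucl n × Eucl n) :
    ℝ≥0∞ :=
  ENNReal.ofReal (primitive g (|w z.1 - w z.2| / ‖z.1 - z.2‖ ^ s) / ‖z.1 - z.2‖ ^ n)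

/-- The Caccioppoli inequality for truncations of subsolutions. -/
theorem IsWeakSubsolution.caccioppoli {s : ℝ} {Ω : Set (Eucl n)} {u : Eucl n → ℝ}
    (hu : IsWeakSubsolution s g K Ω u) (hg : IsGrowthFunction p q g) {N : ℕ} (hN : q ≤ N)
    (hK : IsKernel lam Lam K) (hlam : 0 < lam) (hLam : lam ≤ Lam) (hn : 1 ≤ n)
    (hs0 : 0 < s) (hs1 : s < 1) {k : ℝ} (hk : 0 ≤ k)
    {φ : Eucl n → ℝ} {L r : ℝ} (hr : 0 < r) (hLr : 1 ≤ L * r)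
    (hφ : ∀ x y, |φ x - φ y| ≤ L * ‖x - y‖) (hφ0 : ∀ x, 0 ≤ φ x) (hφ1 : ∀ x, φ x ≤ 1)
    (hφm : AEMeasurable φ volume)
    {A B : Set (Eucl n)} (hA : MeasurableSet A) (hB : MeasurableSet B) (hAB : A ⊆ B) (hBΩ : B ⊆ Ω)
    (hφA : ∀ x ∈ A, φ x = 1) (hφB : ∀ x ∉ B, φ x = 0) {x₀ : Eucl n} {M : ℝ} (hM : 1 ≤ M)
    (hpos : ∀ y ∉ B, 0 < ‖y - x₀‖)
    (hfar : ∀ x y, φ x ≠ 0 → y ∉ B → ‖y - x₀‖ ≤ M * ‖x - y‖) :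
    ENNReal.ofReal (lam / 2) * ∫⁻ z in A ×ˢ A, energyDensity s g (trunc u k) z ≤
      2 * (ENNReal.ofReal (Lam * youngConst N) * (ENNReal.ofReal ((L * r) ^ N) * cutoffMass n s *
        ∫⁻ x in B, ENNReal.ofReal (primitive g (trunc u k x / r ^ s)))) +
      2 * (ENNReal.ofReal (Lam * (N * M ^ (N + n + 1))) *
        ((∫⁻ x in B, ENNReal.ofReal (trunc u k x)) *
          ∫⁻ y in Bᶜ, ENNReal.ofReal (tailDensity s g (fun x => max (u x) 0) x₀ y))) := by
  have hLam0 : 0 < Lam := hlam.trans_le hLam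
  have hY := youngConst_nonneg N
  have hL0 : 0 < L := pos_of_mul_pos_left (by linarith) hr.le
  have hum := hu.1.aemeasurable
  have hwm := aemeasurable_trunc hum k
  have hφd : ∀ x y, |φ x - φ y| ≤ 1 := fun x y =>
    abs_le.2 ⟨by linarith [hφ0 x, hφ1 y], by linarith [hφ0 y, hφ1 x]⟩
  set η : Eucl n → ℝ := fun x => φ x ^ (N + 1) * trunc u k x with hη
  have hηW : MemW s g Ω η := by
    -- The power `φ^(N+1)` is Lipschitz with constant `(N+1)L`; the maximum with `1` provides the
    -- bound `1 ≤ L` required for admissibility.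
    refine hu.1.mul_trunc hg hN hn hs0 hs1 hk (L := max 1 ((N + 1) * L)) (le_max_left _ _)
      (fun x y => ?_) (fun x => pow_nonneg (hφ0 x) _) (fun x => pow_le_one₀ (hφ0 x) (hφ1 x))
      (hφm.pow_const _)
    refine (abs_pow_sub_pow_le (hφ0 x) (hφ1 x) (hφ0 y) (hφ1 y) (N + 1)).trans ?_
    have h1 := hφ x y
    calc ((N + 1 : ℕ) : ℝ) * |φ x - φ y| ≤ ((N + 1 : ℕ) : ℝ) * (L * ‖x - y‖) := by gcongr
      _ = (N + 1) * L * ‖x - y‖ := by push_cast; ring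
      _ ≤ _ := by gcongr; exact le_max_right _ _
  have hη0 : ∀ x, 0 ≤ η x := fun x => mul_nonneg (pow_nonneg (hφ0 x) _) (trunc_nonneg _ _ _)
  have hηB : ∀ x ∉ B, η x = 0 := fun x hx => by simp [hη, hφB x hx]
  have hweak := hu.2 η hηW hη0 fun x hx => hηB x fun h => hx (hBΩ h)
  have hI := integrableOn_weakIntegrand hg hN hK hlam hLam hn hu.1 hηW
  set c₁ := ENNReal.ofReal (Lam * youngConst N) with hc₁
  set c₂ := ENNReal.ofReal (Lam * (N * M ^ (N + n + 1))) with hc₂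
  set e : Eucl n × Eucl n → ℝ≥0∞ := fun z => ENNReal.ofReal
    (primitive g (trunc u k z.1 * |φ z.1 - φ z.2| / ‖z.1 - z.2‖ ^ s) / ‖z.1 - z.2‖ ^ n) with he
  set t : Eucl n × Eucl n → ℝ≥0∞ := fun z => ENNReal.ofReal (trunc u k z.1) *
    ENNReal.ofReal (tailDensity s g (fun x => max (u x) 0) x₀ z.2) with ht
  have hem : AEMeasurable e volume := hg.aemeasurable_energy
    ((aemeasurable_fst hwm).mul (continuous_abs.measurable.comp_aemeasurable
      ((aemeasurable_fst hφm).sub (aemeasurable_snd hφm))))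
    fun z => mul_nonneg (trunc_nonneg _ _ _) (abs_nonneg _)
  have hτm : AEMeasurable (tailDensity s g (fun x => max (u x) 0) x₀) volume :=
    hg.aemeasurable_tailDensity s (hum.max aemeasurable_const) x₀
  have htm : AEMeasurable t volume :=
    (aemeasurable_fst hwm).ennreal_ofReal.mul (aemeasurable_snd hτm).ennreal_ofReal
  have hBB := hB.prod hB
  have hBC := hB.prod hB.compl
  have hCB := hB.compl.prod hB
  -- The pairs are split by membership in `B`. Both inside: near-diagonal bound, keeping the energy
  -- only on `A × A`, where `φ = 1`. Exactly one inside: far bound. Both outside: the test function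
  -- vanishes at both points.
  have hmain : ∫⁻ z in crossSet Ω, (A ×ˢ A).indicator
        (fun z => ENNReal.ofReal (lam / 2) * energyDensity s g (trunc u k) z) z ≤
      ∫⁻ z in crossSet Ω, ((B ×ˢ B).indicator (fun z => c₁ * (e z + e z.swap)) z +
        ((B ×ˢ Bᶜ).indicator (fun z => c₂ * t z) z +
          (Bᶜ ×ˢ B).indicator (fun z => c₂ * t z.swap) z)) := by
    refine lintegral_le_of_integral_nonpos hI hweak ?_
    rintro ⟨x, y⟩
    have hfarxy : ∀ x y, y ∉ B →
        ENNReal.ofReal (-weakIntegrand s g K u η x y) ≤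
          ENNReal.ofReal (weakIntegrand s g K u η x y) + c₂ * t (x, y) := by
      intro x y hy
      have h := weakIntegrand_lower_far hg hN hK hlam hLam hn hs0 hs1 hk u hφ0 hφ1 (hφB y hy) hM
        (hpos y hy) fun hx => hfar x y hx hy
      have hw0 := trunc_nonneg u k x
      have hτ0 := hg.tailDensity_nonneg s (fun x => max (u x) 0) x₀ y
      have h' := ofReal_add_ofReal_neg_le le_rfl (by
        have : 0 < M := by linarith
        exact mul_nonneg (by positivity) (mul_nonneg hw0 hτ0)) h
      rw [ENNReal.ofReal_zero, zero_add] at h'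
      simp only [hc₂, ht]
      rw [← ENNReal.ofReal_mul hw0, ← ENNReal.ofReal_mul (by positivity)]
      exact h'
    by_cases hx : x ∈ B <;> by_cases hy : y ∈ B
    · simp only [Set.indicator, Set.mem_prod, hx, hy, and_self, if_true, Set.mem_compl_iff,
        not_true_eq_false, and_false, false_and, if_false, add_zero]
      have h := weakIntegrand_lower hg hN hK hlam hLam hn s k u hφ0 hφ1 x y
      have hE : ∀ x y : Eucl n,
          0 ≤ primitive g (trunc u k x * |φ x - φ y| / ‖x - y‖ ^ s) / ‖x - y‖ ^ n := fun x y =>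
        div_nonneg (hg.primitive_nonneg (by have := trunc_nonneg u k x; positivity))
          (by positivity)
      have hP : 0 ≤ primitive g (|trunc u k x - trunc u k y| / ‖x - y‖ ^ s) / ‖x - y‖ ^ n :=
        div_nonneg (hg.primitive_nonneg (by positivity)) (by positivity)
      have h' := ofReal_add_ofReal_neg_le
        (mul_nonneg (by positivity) (mul_nonneg (pow_nonneg (le_max_of_le_left (hφ0 x)) _) hP))
        (mul_nonneg (by positivity) (add_nonneg (hE x y) (hE y x))) h
      simp only [hc₁, he, Prod.swap_prod_mk]
      rw [← ENNReal.ofReal_add (hE x y) (hE y x), ← ENNReal.ofReal_mul (by positivity)]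
      refine le_trans ?_ h'
      gcongr
      split_ifs with hA2
      · rw [hφA x hA2.1, hφA y hA2.2, max_self, one_pow, one_mul, energyDensity,
          ENNReal.ofReal_mul (by positivity)]
      · exact zero_le
    · have hyA : y ∉ A := fun h => hy (hAB h)
      simpa [Set.indicator, hx, hy, hyA] using hfarxy x y hy
    · have hxA : x ∉ A := fun h => hx (hAB h)
      have h := hfarxy y x hx
      rw [weakIntegrand_swap hK] at h
      simpa [Set.indicator, hx, hy, hxA] using h
    · have hxA : x ∉ A := fun h => hx (hAB h)
      simp [Set.indicator, hx, hy, hxA, weakIntegrand, hηB x hx, hηB y hy]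
  have hsub : A ×ˢ A ⊆ crossSet Ω := fun z hz => Or.inl ⟨hBΩ (hAB hz.1), trivial⟩
  rw [setLIntegral_indicator (hA.prod hA), Set.inter_eq_self_of_subset_left hsub,
    lintegral_const_mul' _ _ ENNReal.ofReal_ne_top] at hmain
  refine hmain.trans ((setLIntegral_le_lintegral _ _).trans ?_)
  have hswap : AEMeasurable (fun z : Eucl n × Eucl n => e z.swap) volume :=
    hem.comp_quasiMeasurePreserving Measure.measurePreserving_swap.quasiMeasurePreserving
  have hm1 : AEMeasurable (fun z => (B ×ˢ B).indicator (fun z => c₁ * (e z + e z.swap)) z) volume :=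
    ((hem.add hswap).const_mul c₁).indicator hBB
  have hm2 : AEMeasurable (fun z => (B ×ˢ Bᶜ).indicator (fun z => c₂ * t z) z) volume :=
    (htm.const_mul c₂).indicator hBC
  rw [lintegral_add_left' hm1, lintegral_add_left' hm2,
    lintegral_indicator hBB, lintegral_indicator hBC, lintegral_indicator hCB,
    lintegral_const_mul' _ _ ENNReal.ofReal_ne_top, lintegral_const_mul' _ _ ENNReal.ofReal_ne_top,
    lintegral_const_mul' _ _ ENNReal.ofReal_ne_top, lintegral_add_left' hem.restrict,
    ← setLIntegral_swap B B e, ← setLIntegral_swap B Bᶜ t, ← two_mul, ← two_mul]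
  have h1 := hg.setLIntegral_cutoff_le hN hs0 hs1 hr hLr hφ hφd hφm hwm (trunc_nonneg u k) B B
  have h2 : ∫⁻ z in B ×ˢ Bᶜ, t z = (∫⁻ x in B, ENNReal.ofReal (trunc u k x)) *
      ∫⁻ y in Bᶜ, ENNReal.ofReal (tailDensity s g (fun x => max (u x) 0) x₀ y) := by
    rw [Measure.volume_eq_prod, ← Measure.prod_restrict]
    exact lintegral_prod_mul hwm.ennreal_ofReal.restrict hτm.ennreal_ofReal.restrict
  rw [h2, mul_left_comm]
  gcongr

end Energy

end FractionalOrlicz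

namespace FractionalOrlicz

/-! ### The Faber–Krahn inequality, level modulars and cutoffs -/

section Step

variable {n : ℕ} {p q lam Lam : ℝ} {g : ℝ → ℝ} {K : Eucl n → Eucl n → ℝ≥0∞}

/-- A Faber–Krahn inequality: a function with small support in a ball is controlled by its energy
with a gain in the size of the support. -/
theorem IsGrowthFunction.faberKrahn (hg : IsGrowthFunction p q g) (hn : 1 ≤ n) {s : ℝ}
    (hs0 : 0 < s) {v : Eucl n → ℝ} (hv : AEMeasurable v volume)
    (hv0 : ∀ x, 0 ≤ v x) {x₀ : Eucl n} {R d r ρ : ℝ} (hρ : 0 < ρ) (hρd : ρ ≤ d) (hρr : ρ ≤ r)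
    (hS : volume (Metric.ball x₀ (R + d) ∩ {x | v x ≠ 0}) ≤
      volume (Metric.ball (0 : Eucl n) ρ) / 2) :
    volume (Metric.ball (0 : Eucl n) 1) / 2 *
        ∫⁻ x in Metric.ball x₀ R, ENNReal.ofReal (primitive g (v x / r ^ s)) ≤
      ENNReal.ofReal ((ρ / r) ^ s) *
        ∫⁻ z in Metric.ball x₀ (R + d) ×ˢ Metric.ball x₀ (R + d), energyDensity s g v z := by
  have : Nontrivial (Eucl n) := Module.nontrivial_of_finrank_pos (R := ℝ) (by simp; omega)
  have hr : 0 < r := hρ.trans_le hρr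
  set A := Metric.ball x₀ (R + d) with hA
  set ω := volume (Metric.ball (0 : Eucl n) 1) with hω
  have hem : AEMeasurable (energyDensity s g v) volume :=
    hg.aemeasurable_energy (continuous_abs.measurable.comp_aemeasurable
      ((aemeasurable_fst hv).sub (aemeasurable_snd hv))) fun z => abs_nonneg _
  have hvol : ∀ x : Eucl n, volume (Metric.ball x ρ) = ENNReal.ofReal (ρ ^ n) * ω := fun x => by
    rw [Measure.addHaar_ball _ _ hρ.le]; simp [hω]
  have hρn0 : ENNReal.ofReal (ρ ^ n) ≠ 0 := by simpa using pow_pos hρ n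
  have hGm : AEMeasurable (fun x => ENNReal.ofReal (primitive g (v x / r ^ s)))
      (volume.restrict (Metric.ball x₀ R)) :=
    (hg.aemeasurable_primitive_comp (hv.div_const _) fun x => by
      have := hv0 x; positivity).ennreal_ofReal.restrict
  have hRA : Metric.ball x₀ R ⊆ A := Metric.ball_subset_ball (by linarith)
  have hpt : ∀ x ∈ Metric.ball x₀ R,
      ω / 2 * ENNReal.ofReal (primitive g (v x / r ^ s)) ≤
        ENNReal.ofReal ((ρ / r) ^ s) * ∫⁻ y in A, energyDensity s g v (x, y) := by
    intro x hx
    have hxA : Metric.ball x ρ ⊆ A := by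
      refine Metric.ball_subset_ball' ?_
      have := Metric.mem_ball.1 hx
      linarith
    -- `T` consists of zeros of `v` and fills at least half of `B_ρ(x)`; only these interactions are
    -- retained.
    set T := Metric.ball x ρ \ (A ∩ {x | v x ≠ 0}) with hT
    have hTm : NullMeasurableSet T volume := by
      refine Metric.isOpen_ball.measurableSet.nullMeasurableSet.diff
        (Metric.isOpen_ball.measurableSet.nullMeasurableSet.inter ?_)
      exact hv.nullMeasurable (measurableSet_singleton (0 : ℝ)).compl
    have hTvol : ENNReal.ofReal (ρ ^ n) * (ω / 2) ≤ volume T := by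
      have h1 : volume (Metric.ball x ρ) - volume (Metric.ball x ρ) / 2 ≤ volume T := by
        refine le_trans (tsub_le_tsub_left ?_ _) le_measure_sdiff
        rw [hvol x, ← hvol 0]
        exact hS
      rw [ENNReal.sub_half measure_ball_lt_top.ne, hvol, mul_div_assoc] at h1
      exact h1
    have hT1 : ∀ y ∈ T, ENNReal.ofReal (primitive g (v x / r ^ s)) ≤
        ENNReal.ofReal ((ρ / r) ^ s * ρ ^ n) * energyDensity s g v (x, y) := by
      intro y hy
      have hyρ : ‖x - y‖ < ρ := by
        have := Metric.mem_ball'.1 hy.1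
        rwa [dist_eq_norm] at this
      have hvy : v y = 0 := by
        by_contra hcon
        exact hy.2 ⟨hxA hy.1, hcon⟩
      rw [energyDensity, ← ENNReal.ofReal_mul (by positivity)]
      refine ENNReal.ofReal_le_ofReal ?_
      simp only [hvy, sub_zero, abs_of_nonneg (hv0 x)]
      rcases eq_or_ne x y with rfl | hxy
      · simp [hvy, primitive_zero]
      have hd : 0 < ‖x - y‖ := norm_pos_iff.2 (sub_ne_zero.2 hxy)
      have hv0x := hv0 x
      -- The gain: since `|x - y| < ρ ≤ r`, the factor `(|x - y|/r)^s` is at most `1` and leaves `G`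
      -- linearly.
      have e1 : v x / r ^ s = (‖x - y‖ / r) ^ s * (v x / ‖x - y‖ ^ s) := by
        rw [Real.div_rpow hd.le hr.le]; field_simp
      have hG := hg.primitive_nonneg (t := v x / ‖x - y‖ ^ s) (by positivity)
      rw [e1]
      refine (hg.primitive_mul_le (by positivity) (Real.rpow_le_one (by positivity)
        ((div_le_one hr).2 (hyρ.le.trans hρr)) hs0.le) (by positivity)).trans ?_
      have e2 : (ρ / r) ^ s * ρ ^ n * (primitive g (v x / ‖x - y‖ ^ s) / ‖x - y‖ ^ n) =
        (ρ / r) ^ s * primitive g (v x / ‖x - y‖ ^ s) * (ρ ^ n / ‖x - y‖ ^ n) := by ring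
      rw [e2]
      have h1 : 1 ≤ ρ ^ n / ‖x - y‖ ^ n := by
        rw [one_le_div (by positivity)]; gcongr
      calc (‖x - y‖ / r) ^ s * primitive g (v x / ‖x - y‖ ^ s)
          ≤ (ρ / r) ^ s * primitive g (v x / ‖x - y‖ ^ s) := by gcongr
        _ ≤ _ := le_mul_of_one_le_right (by positivity) h1
    have h2 : ENNReal.ofReal (primitive g (v x / r ^ s)) * volume T ≤
        ENNReal.ofReal ((ρ / r) ^ s * ρ ^ n) * ∫⁻ y in A, energyDensity s g v (x, y) := by
      rw [← setLIntegral_const, ← lintegral_const_mul' _ _ ENNReal.ofReal_ne_top]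
      refine le_trans (lintegral_mono_ae ?_)
        (lintegral_mono_set (Set.sdiff_subset.trans hxA))
      filter_upwards [ae_restrict_mem₀ hTm] with y hy using hT1 y hy
    rw [ENNReal.ofReal_mul (by positivity)] at h2
    have h3 : ENNReal.ofReal (ρ ^ n) * (ω / 2 * ENNReal.ofReal (primitive g (v x / r ^ s))) ≤
        ENNReal.ofReal (ρ ^ n) *
          (ENNReal.ofReal ((ρ / r) ^ s) * ∫⁻ y in A, energyDensity s g v (x, y)) :=
      calc _ = ENNReal.ofReal (primitive g (v x / r ^ s)) * (ENNReal.ofReal (ρ ^ n) * (ω / 2)) := by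
            ring
        _ ≤ ENNReal.ofReal (primitive g (v x / r ^ s)) * volume T := by gcongr
        _ ≤ _ := h2
        _ = _ := by ring
    exact (ENNReal.mul_le_mul_iff_right hρn0 ENNReal.ofReal_ne_top).1 h3
  calc ω / 2 * ∫⁻ x in Metric.ball x₀ R, ENNReal.ofReal (primitive g (v x / r ^ s))
      = ∫⁻ x in Metric.ball x₀ R, ω / 2 * ENNReal.ofReal (primitive g (v x / r ^ s)) :=
        (lintegral_const_mul'' _ hGm).symm
    _ ≤ ∫⁻ x in Metric.ball x₀ R,
          ENNReal.ofReal ((ρ / r) ^ s) * ∫⁻ y in A, energyDensity s g v (x, y) :=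
        setLIntegral_mono' Metric.isOpen_ball.measurableSet hpt
    _ = ENNReal.ofReal ((ρ / r) ^ s) *
          ∫⁻ x in Metric.ball x₀ R, ∫⁻ y in A, energyDensity s g v (x, y) :=
        lintegral_const_mul' _ _ ENNReal.ofReal_ne_top
    _ ≤ ENNReal.ofReal ((ρ / r) ^ s) *
          ∫⁻ x in A, ∫⁻ y in A, energyDensity s g v (x, y) := by gcongr
    _ = _ := by rw [setLIntegral_prod_eq A A hem]

/-- The truncated modular over a ball, the quantity iterated by De Giorgi's method. -/
noncomputable def levelModular (s : ℝ) (g : ℝ → ℝ) (u : Eucl n → ℝ) (x₀ : Eucl n) (r R k : ℝ) :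
    ℝ≥0∞ :=
  ∫⁻ x in Metric.ball x₀ R, ENNReal.ofReal (primitive g (trunc u k x / r ^ s))

theorem trunc_anti (u : Eucl n → ℝ) {h l : ℝ} (hhl : h ≤ l) (x : Eucl n) :
    trunc u l x ≤ trunc u h x :=
  max_le_max (by linarith) le_rfl

theorem IsGrowthFunction.levelModular_mono (hg : IsGrowthFunction p q g) {s r : ℝ} (hr : 0 < r)
    (u : Eucl n → ℝ) (x₀ : Eucl n) {R R' h l : ℝ} (hR : R ≤ R') (hhl : h ≤ l) :
    levelModular s g u x₀ r R l ≤ levelModular s g u x₀ r R' h := by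
  refine (lintegral_mono fun x => ENNReal.ofReal_le_ofReal (hg.primitive_mono ?_ ?_)).trans
    (lintegral_mono_set (Metric.ball_subset_ball hR))
  · have := trunc_nonneg u l x; positivity
  · have := trunc_anti u hhl x; gcongr

/-- A radial cutoff function. -/
noncomputable def radialCutoff (x₀ : Eucl n) (R d : ℝ) (x : Eucl n) : ℝ :=
  max 0 (min 1 ((R + d - ‖x - x₀‖) / d))

theorem radialCutoff_lipschitz (x₀ : Eucl n) (R : ℝ) {d : ℝ} (hd : 0 < d) (x y : Eucl n) :
    |radialCutoff x₀ R d x - radialCutoff x₀ R d y| ≤ d⁻¹ * ‖x - y‖ := by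
  have h1 := abs_max_sub_max_le_abs (min 1 ((R + d - ‖x - x₀‖) / d))
    (min 1 ((R + d - ‖y - x₀‖) / d)) 0
  have h2 := abs_min_sub_min_le_max 1 ((R + d - ‖x - x₀‖) / d) 1 ((R + d - ‖y - x₀‖) / d)
  rw [sub_self, abs_zero, max_eq_right (abs_nonneg _)] at h2
  rw [max_comm _ 0, max_comm _ 0] at h1
  refine h1.trans (h2.trans ?_)
  rw [← sub_div, abs_div, abs_of_pos hd, inv_mul_eq_div]
  gcongr
  have h3 := abs_norm_sub_norm_le (y - x₀) (x - x₀)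
  have e : R + d - ‖x - x₀‖ - (R + d - ‖y - x₀‖) = ‖y - x₀‖ - ‖x - x₀‖ := by ring
  rw [e]
  refine h3.trans_eq ?_
  rw [norm_sub_rev]
  congr 1
  abel

end Step

end FractionalOrlicz

namespace FractionalOrlicz

/-! ### One step of the De Giorgi iteration -/

section StepEstimate

variable {n : ℕ} {p q lam Lam : ℝ} {g : ℝ → ℝ} {K : Eucl n → Eucl n → ℝ≥0∞}

/-- The right-hand side of the Caccioppoli inequality when the tail is dominated by the level. -/
theorem IsWeakSubsolution.energy_le {s : ℝ} {Ω : Set (Eucl n)} {u : Eucl n → ℝ}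
    (hu : IsWeakSubsolution s g K Ω u) (hg : IsGrowthFunction p q g) {N : ℕ} (hN : q ≤ N)
    (hK : IsKernel lam Lam K) (hlam : 0 < lam) (hLam : lam ≤ Lam) (hn : 1 ≤ n)
    (hs0 : 0 < s) (hs1 : s < 1) {x₀ : Eucl n} {r : ℝ} (hr : 0 < r) (hΩ : Metric.ball x₀ r ⊆ Ω)
    {k : ℝ} (hk : 0 < k)
    (htail : ∫⁻ y in (Metric.ball x₀ (r / 2))ᶜ,
      ENNReal.ofReal (tailDensity s g (fun x => max (u x) 0) x₀ y) ≤
        ENNReal.ofReal (g (k / r ^ s) / r ^ s))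
    {R d h l β : ℝ} (hR : r / 2 ≤ R) (hd : 0 < d) (hRd : R + 3 * d ≤ r) (hβ : 1 ≤ β)
    (hβd : r ≤ β * d) (hh : 0 ≤ h) (hhl : k ≤ β * (l - h)) :
    ENNReal.ofReal (lam / 2) * ∫⁻ z in Metric.ball x₀ (R + d) ×ˢ Metric.ball x₀ (R + d),
        energyDensity s g (trunc u l) z ≤
      ENNReal.ofReal ((2 * Lam * youngConst N * (cutoffMass n s).toReal + 2 * Lam * N ^ 3) *
        β ^ (2 * N + n + 1)) * levelModular s g u x₀ r (R + 3 * d) h := by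
  have hLam0 : 0 < Lam := hlam.trans_le hLam
  have hY := youngConst_nonneg N
  have hβ0 : 0 < β := by linarith
  have hR0 : 0 < R := by linarith
  have hlh : 0 < l - h := pos_of_mul_pos_right (hk.trans_le hhl) hβ0.le
  have hS0 : 0 < r ^ s := by positivity
  set φ := radialCutoff x₀ (R + d) d with hφ
  have hφ0 : ∀ x, 0 ≤ φ x := fun x => le_max_left _ _
  have hφ1 : ∀ x, φ x ≤ 1 := fun x => max_le zero_le_one (min_le_left _ _)
  have hφm : AEMeasurable φ volume := by
    have : Continuous φ := by
      rw [hφ]; unfold radialCutoff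
      fun_prop
    exact this.measurable.aemeasurable
  have hLr : 1 ≤ d⁻¹ * r := by
    rw [inv_mul_eq_div, one_le_div hd]; linarith
  have hφB : ∀ x, φ x ≠ 0 → ‖x - x₀‖ < R + 2 * d := by
    intro x hx
    by_contra hcon
    refine hx (max_eq_left ((min_le_right _ _).trans ?_))
    exact div_nonpos_of_nonpos_of_nonneg (by linarith) hd.le
  set B := Metric.ball x₀ (R + 3 * d) with hB
  have hnB : ∀ y ∉ B, R + 3 * d ≤ ‖y - x₀‖ := fun y hy => by
    rw [hB, mem_ball_iff_norm] at hy; exact not_lt.1 hy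
  have hcacc := hu.caccioppoli hg hN hK hlam hLam hn hs0 hs1 (k := l) (by linarith) hr hLr
    (radialCutoff_lipschitz x₀ (R + d) hd) hφ0 hφ1 hφm (A := Metric.ball x₀ (R + d)) (B := B)
    Metric.isOpen_ball.measurableSet Metric.isOpen_ball.measurableSet
    (Metric.ball_subset_ball (by linarith)) ((Metric.ball_subset_ball hRd).trans hΩ)
    (fun x hx => by
      rw [mem_ball_iff_norm] at hx
      have : 1 ≤ (R + d + d - ‖x - x₀‖) / d := by
        rw [one_le_div hd]; linarith
      rw [radialCutoff, min_eq_left this]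
      exact max_eq_right zero_le_one)
    (fun x hx => by
      by_contra hcon
      have h1 := hφB x hcon
      have h2 := hnB x hx
      linarith) (x₀ := x₀) hβ
    (fun y hy => by have := hnB y hy; linarith)
    -- The cutoff vanishes from radius `R + 2d` on and `y` lies beyond `R + 3d`, so `|x - y| ≥ d`.
    -- As `R + 2d ≤ r - d ≤ (β - 1)d`, the separation constant can be taken to be `β`.
    (fun x y hx hy => by
      have h1 := hφB x hx
      have h2 := hnB y hy
      have h3 : ‖y - x₀‖ ≤ ‖x - y‖ + ‖x - x₀‖ := by
        have := norm_sub_le_norm_sub_add_norm_sub y x x₀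
        rwa [norm_sub_rev y x] at this
      have h4 : (β - 1) * d ≤ (β - 1) * ‖x - y‖ := by
        refine mul_le_mul_of_nonneg_left ?_ (by linarith)
        linarith
      linarith)
  refine hcacc.trans ?_
  have hJ : cutoffMass n s = ENNReal.ofReal (cutoffMass n s).toReal :=
    (ENNReal.ofReal_toReal (cutoffMass_lt_top hn hs0 hs1).ne).symm
  have hmod : ∫⁻ x in B, ENNReal.ofReal (primitive g (trunc u l x / r ^ s)) ≤
      levelModular s g u x₀ r (R + 3 * d) h :=
    hg.levelModular_mono hr u x₀ le_rfl (by linarith)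
  have h1 : ENNReal.ofReal ((d⁻¹ * r) ^ N) ≤ ENNReal.ofReal (β ^ N) := by
    refine ENNReal.ofReal_le_ofReal ?_
    gcongr
    rw [inv_mul_eq_div, div_le_iff₀ hd]
    exact hβd
  have htailB : ∫⁻ y in Bᶜ, ENNReal.ofReal (tailDensity s g (fun x => max (u x) 0) x₀ y) ≤
      ENNReal.ofReal (g (k / r ^ s) / r ^ s) :=
    (lintegral_mono_set (Set.compl_subset_compl.2
      (Metric.ball_subset_ball (by linarith)))).trans htail
  -- The tail term becomes a modular at the lower level: where `u > l` one has `k ≤ β(l - h) ≤ β(u -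
  -- h)_+`, so `g(k/r^s)` is absorbed by doubling and `t g(t) ≤ N G(t)` finishes.
  have h2 : (∫⁻ x in B, ENNReal.ofReal (trunc u l x)) * ENNReal.ofReal (g (k / r ^ s) / r ^ s) ≤
      ENNReal.ofReal (N ^ 2 * β ^ N) * levelModular s g u x₀ r (R + 3 * d) h := by
    rw [levelModular, ← lintegral_const_mul' _ _ ENNReal.ofReal_ne_top,
      ← lintegral_mul_const' _ _ ENNReal.ofReal_ne_top]
    refine lintegral_mono fun x => ?_
    have hW := trunc_nonneg u h x
    have hw := trunc_nonneg u l x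
    rw [← ENNReal.ofReal_mul hw, ← ENNReal.ofReal_mul (by positivity)]
    refine ENNReal.ofReal_le_ofReal ?_
    have hG0 := hg.primitive_nonneg (t := trunc u h x / r ^ s) (by positivity)
    rcases hw.eq_or_lt with h0 | hpos
    · rw [← h0, zero_mul]; positivity
    have hlu : 0 < u x - l := by
      by_contra hcon
      rw [trunc, max_eq_right (not_lt.1 hcon)] at hpos
      exact lt_irrefl _ hpos
    have hkW : k ≤ β * trunc u h x := by
      refine hhl.trans ?_
      gcongr
      exact le_trans (by linarith) (le_max_left _ _)
    have hgk : g (k / r ^ s) ≤ N * β ^ N * g (trunc u h x / r ^ s) := by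
      refine le_trans (hg.mono (by positivity) ?_) (hg.map_mul_le_pow hN hβ (by positivity))
      rw [← mul_div_assoc]
      gcongr
    have hgW := hg.nonneg (t := trunc u h x / r ^ s) (by positivity)
    calc trunc u l x * (g (k / r ^ s) / r ^ s)
        ≤ trunc u h x * (N * β ^ N * g (trunc u h x / r ^ s) / r ^ s) := by
          have := hg.nonneg (t := k / r ^ s) (by positivity)
          gcongr
          exact trunc_anti u (by linarith) x
      _ = N * β ^ N * (trunc u h x / r ^ s * g (trunc u h x / r ^ s)) := by ring
      _ ≤ N * β ^ N * (N * primitive g (trunc u h x / r ^ s)) :=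
          mul_le_mul_of_nonneg_left (hg.mul_le_primitive hN (by positivity)) (by positivity)
      _ = _ := by ring
  set Y := levelModular s g u x₀ r (R + 3 * d) h with hYdef
  -- The cutoff term carries `β^N` and the tail term `β^(N+n+1) β^N`; the latter fixes the common
  -- exponent.
  have hb1 : β ^ N ≤ β ^ (2 * N + n + 1) := pow_le_pow_right₀ hβ (by omega)
  have hJ0 : 0 ≤ (cutoffMass n s).toReal := ENNReal.toReal_nonneg
  have two : (2 : ℝ≥0∞) = ENNReal.ofReal 2 := by simp
  calc 2 * (ENNReal.ofReal (Lam * youngConst N) * (ENNReal.ofReal ((d⁻¹ * r) ^ N) *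
          cutoffMass n s * ∫⁻ x in B, ENNReal.ofReal (primitive g (trunc u l x / r ^ s)))) +
      2 * (ENNReal.ofReal (Lam * (N * β ^ (N + n + 1))) *
        ((∫⁻ x in B, ENNReal.ofReal (trunc u l x)) *
          ∫⁻ y in Bᶜ, ENNReal.ofReal (tailDensity s g (fun x => max (u x) 0) x₀ y)))
      ≤ 2 * (ENNReal.ofReal (Lam * youngConst N) * (ENNReal.ofReal (β ^ N) *
          cutoffMass n s * Y)) +
        2 * (ENNReal.ofReal (Lam * (N * β ^ (N + n + 1))) *
          (ENNReal.ofReal (N ^ 2 * β ^ N) * Y)) := by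
        refine add_le_add ?_ (mul_le_mul' le_rfl (mul_le_mul' le_rfl
          ((mul_le_mul' le_rfl htailB).trans h2)))
        gcongr
    _ = ENNReal.ofReal (2 * (Lam * youngConst N * (β ^ N * (cutoffMass n s).toReal)) +
          2 * (Lam * (N * β ^ (N + n + 1)) * (N ^ 2 * β ^ N))) * Y := by
        rw [hJ, two, ENNReal.ofReal_add (by positivity) (by positivity), add_mul,
          ENNReal.ofReal_mul (p := 2) (by norm_num), ENNReal.ofReal_mul (p := 2) (by norm_num),
          ENNReal.ofReal_mul (p := Lam * youngConst N) (by positivity),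
          ENNReal.ofReal_mul (p := β ^ N) (by positivity),
          ENNReal.ofReal_mul (p := Lam * (N * β ^ (N + n + 1))) (by positivity),
          ENNReal.toReal_ofReal hJ0]
        ring
    _ ≤ _ := by
        gcongr
        have e : Lam * (N * β ^ (N + n + 1)) * (N ^ 2 * β ^ N) =
            Lam * N ^ 3 * β ^ (2 * N + n + 1) := by
          rw [show 2 * N + n + 1 = (N + n + 1) + N by ring, pow_add β (N + n + 1) N]; ring
        rw [e, add_mul]
        have h5 : Lam * youngConst N * (β ^ N * (cutoffMass n s).toReal) ≤
            Lam * youngConst N * (β ^ (2 * N + n + 1) * (cutoffMass n s).toReal) := by gcongr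
        linarith

/-- The constant in one step of the De Giorgi iteration. -/
noncomputable def stepConst (n N : ℕ) (s lam Lam : ℝ) : ℝ :=
  (2 * Lam * youngConst N * (cutoffMass n s).toReal + 2 * Lam * N ^ 3) /
    (lam / 2 * ((volume (Metric.ball (0 : Eucl n) 1)).toReal / 2)) + 1

/-- The summand `1` in `stepConst` is there for this bound, which serves the trivial regime `d < ρ`
of the step and the requirement `δ ≤ 1` in the iteration. -/
theorem stepConst_ge_one (n N : ℕ) (s : ℝ) (hlam : 0 < lam) (hLam : lam ≤ Lam) :
    1 ≤ stepConst n N s lam Lam := by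
  have hY := youngConst_nonneg N
  have : 0 < Lam := hlam.trans_le hLam
  refine le_add_of_nonneg_left (div_nonneg ?_ ?_) <;> positivity

/-- One step of the De Giorgi iteration. -/
theorem IsWeakSubsolution.levelModular_step {s : ℝ} {Ω : Set (Eucl n)} {u : Eucl n → ℝ}
    (hu : IsWeakSubsolution s g K Ω u) (hg : IsGrowthFunction p q g) {N : ℕ} (hN : q ≤ N)
    (hK : IsKernel lam Lam K) (hlam : 0 < lam) (hLam : lam ≤ Lam) (hn : 1 ≤ n)
    (hs0 : 0 < s) (hs1 : s < 1) {x₀ : Eucl n} {r : ℝ} (hr : 0 < r) (hΩ : Metric.ball x₀ r ⊆ Ω)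
    {k : ℝ} (hk : 0 < k)
    (htail : ∫⁻ y in (Metric.ball x₀ (r / 2))ᶜ,
      ENNReal.ofReal (tailDensity s g (fun x => max (u x) 0) x₀ y) ≤
        ENNReal.ofReal (g (k / r ^ s) / r ^ s))
    {R d h l β ρ : ℝ} (hR : r / 2 ≤ R) (hd : 0 < d) (hRd : R + 3 * d ≤ r) (hβ : 1 ≤ β)
    (hβd : r ≤ β * d) (hh : 0 ≤ h) (hhl : k ≤ β * (l - h)) (hρ : 0 < ρ)
    (hS : volume (Metric.ball x₀ (R + d) ∩ {x | trunc u l x ≠ 0}) ≤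
      volume (Metric.ball (0 : Eucl n) ρ) / 2) :
    levelModular s g u x₀ r R l ≤
      ENNReal.ofReal (stepConst n N s lam Lam * β ^ (2 * N + n + 1) * (ρ / r) ^ s) *
        levelModular s g u x₀ r (R + 3 * d) h := by
  have hC1 := stepConst_ge_one n N s hlam hLam
  have hβ0 : 0 < β := by linarith
  have hlh : 0 < l - h := pos_of_mul_pos_right (hk.trans_le hhl) hβ0.le
  -- Balls of radius `ρ > d` need not stay in `B_{R+d}`, so Faber–Krahn does not apply. But then `β
  -- ρ / r ≥ 1`, the claimed factor is at least `1`, and monotonicity of the modular suffices.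
  rcases lt_or_ge d ρ with hdρ | hρd
  · have h1 : 1 ≤ stepConst n N s lam Lam * β ^ (2 * N + n + 1) * (ρ / r) ^ s := by
      have h2 : 1 ≤ β * (ρ / r) := by
        rw [← mul_div_assoc, one_le_div hr]
        refine hβd.trans ?_
        gcongr
      have h3 : 1 ≤ (β * (ρ / r)) ^ s := Real.one_le_rpow h2 hs0.le
      rw [Real.mul_rpow hβ0.le (by positivity)] at h3
      calc (1 : ℝ) ≤ β ^ s * (ρ / r) ^ s := h3
        _ ≤ β ^ (2 * N + n + 1) * (ρ / r) ^ s := by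
          gcongr
          calc β ^ s ≤ β ^ (1 : ℝ) := Real.rpow_le_rpow_of_exponent_le hβ hs1.le
            _ = β ^ 1 := by simp
            _ ≤ _ := pow_le_pow_right₀ hβ (by omega)
        _ ≤ _ := by
          gcongr
          exact le_mul_of_one_le_left (by positivity) hC1
    calc levelModular s g u x₀ r R l ≤ levelModular s g u x₀ r (R + 3 * d) h :=
          hg.levelModular_mono hr u x₀ (by linarith) (by linarith)
      _ = ENNReal.ofReal 1 * levelModular s g u x₀ r (R + 3 * d) h := by simp
      _ ≤ _ := by gcongr
  have hE := hu.energy_le hg hN hK hlam hLam hn hs0 hs1 hr hΩ hk htail hR hd hRd hβ hβd hh hhl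
  have hF := hg.faberKrahn (s := s) hn hs0 (aemeasurable_trunc hu.1.aemeasurable l)
    (trunc_nonneg u l) (r := r) hρ hρd (by linarith) hS
  set ω := volume (Metric.ball (0 : Eucl n) 1) with hω
  have hω0 : 0 < ω := Metric.measure_ball_pos _ _ one_pos
  have hωt : ω ≠ ∞ := measure_ball_lt_top.ne
  have hωr : 0 < ω.toReal := ENNReal.toReal_pos hω0.ne' hωt
  have hω2 : ω / 2 = ENNReal.ofReal (ω.toReal / 2) := by
    rw [ENNReal.ofReal_div_of_pos two_pos, ENNReal.ofReal_toReal hωt]; simp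
  set C := 2 * Lam * youngConst N * (cutoffMass n s).toReal + 2 * Lam * N ^ 3 with hC
  set Y := levelModular s g u x₀ r (R + 3 * d) h
  set E := ∫⁻ z in Metric.ball x₀ (R + d) ×ˢ Metric.ball x₀ (R + d),
        energyDensity s g (trunc u l) z
  have hc0 : 0 < lam / 2 * (ω.toReal / 2) := by positivity
  have hcne : ENNReal.ofReal (lam / 2 * (ω.toReal / 2)) ≠ 0 := by simpa using hc0
  refine (ENNReal.mul_le_mul_iff_right hcne ENNReal.ofReal_ne_top).1 ?_
  have hY := youngConst_nonneg N
  have hLam0 : 0 < Lam := hlam.trans_le hLam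
  have hJ0 : 0 ≤ (cutoffMass n s).toReal := ENNReal.toReal_nonneg
  have hC0 : 0 ≤ C := by positivity
  calc ENNReal.ofReal (lam / 2 * (ω.toReal / 2)) * levelModular s g u x₀ r R l
      = ENNReal.ofReal (lam / 2) * (ω / 2 * levelModular s g u x₀ r R l) := by
        rw [hω2, ENNReal.ofReal_mul (by positivity), mul_assoc]
    _ ≤ ENNReal.ofReal (lam / 2) * (ENNReal.ofReal ((ρ / r) ^ s) * E) := by
        exact mul_le_mul' le_rfl hF
    _ = ENNReal.ofReal ((ρ / r) ^ s) * (ENNReal.ofReal (lam / 2) * E) := by ring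
    _ ≤ ENNReal.ofReal ((ρ / r) ^ s) * (ENNReal.ofReal (C * β ^ (2 * N + n + 1)) * Y) := by
        gcongr
    _ = ENNReal.ofReal ((ρ / r) ^ s * (C * β ^ (2 * N + n + 1))) * Y := by
        rw [ENNReal.ofReal_mul (p := (ρ / r) ^ s) (by positivity), mul_assoc]
    _ ≤ ENNReal.ofReal (lam / 2 * (ω.toReal / 2) *
          (stepConst n N s lam Lam * β ^ (2 * N + n + 1) * (ρ / r) ^ s)) * Y := by
        refine mul_le_mul' (ENNReal.ofReal_le_ofReal ?_) le_rfl
        have e : lam / 2 * (ω.toReal / 2) * stepConst n N s lam Lam =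
            C + lam / 2 * (ω.toReal / 2) := by
          rw [stepConst, mul_add, mul_one, mul_div_cancel₀ _ hc0.ne']
        calc (ρ / r) ^ s * (C * β ^ (2 * N + n + 1))
            ≤ (ρ / r) ^ s * ((C + lam / 2 * (ω.toReal / 2)) * β ^ (2 * N + n + 1)) := by
              gcongr
              linarith
          _ = _ := by rw [← e]; ring
    _ = _ := by rw [ENNReal.ofReal_mul (by positivity), mul_assoc]

end StepEstimate

end FractionalOrlicz

namespace FractionalOrlicz

/-! ### The De Giorgi iteration -/

section Iteration

variable {n : ℕ} {p q lam Lam : ℝ} {g : ℝ → ℝ} {K : Eucl n → Eucl n → ℝ≥0∞}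

/-- Chebyshev's inequality for the superlevel sets. -/
theorem IsGrowthFunction.measure_level_le (hg : IsGrowthFunction p q g) {N : ℕ} (hN : q ≤ N)
    {s : ℝ} {u : Eucl n → ℝ} (hu : AEMeasurable u volume) (x₀ : Eucl n) {r R R' k h l β : ℝ}
    (hr : 0 < r) (hR : R ≤ R') (hk : 0 ≤ k) (hβ : 1 ≤ β) (hhl : k ≤ β * (l - h)) :
    ENNReal.ofReal (primitive g (k / r ^ s)) *
        volume (Metric.ball x₀ R ∩ {x | trunc u l x ≠ 0}) ≤
      ENNReal.ofReal (β ^ N) * levelModular s g u x₀ r R' h := by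
  have hS0 : 0 < r ^ s := by positivity
  have hGm : AEMeasurable (fun x => ENNReal.ofReal (β ^ N) *
      ENNReal.ofReal (primitive g (trunc u h x / r ^ s))) (volume.restrict (Metric.ball x₀ R')) :=
    ((hg.aemeasurable_primitive_comp ((aemeasurable_trunc hu h).div_const _) fun x => by
      have := trunc_nonneg u h x; positivity).ennreal_ofReal.const_mul _).restrict
  have h1 := mul_meas_ge_le_lintegral₀ hGm (ENNReal.ofReal (primitive g (k / r ^ s)))
  rw [lintegral_const_mul' _ _ ENNReal.ofReal_ne_top] at h1
  refine le_trans ?_ h1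
  refine mul_le_mul' le_rfl (le_trans (measure_mono ?_) (Measure.le_restrict_apply _ _))
  rintro x ⟨hx, hlx⟩
  refine ⟨?_, Metric.ball_subset_ball hR hx⟩
  have hW := trunc_nonneg u h x
  have hlu : 0 < u x - l := by
    by_contra hcon
    exact hlx (by rw [trunc, max_eq_right (not_lt.1 hcon)])
  have hkW : k ≤ β * trunc u h x := by
    refine hhl.trans ?_
    gcongr
    exact le_trans (by linarith) (le_max_left _ _)
  rw [Set.mem_ofPred_eq, ← ENNReal.ofReal_mul (by positivity)]
  refine ENNReal.ofReal_le_ofReal ?_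
  refine le_trans (hg.primitive_mono (by positivity) ?_)
    (hg.primitive_mul_le_pow hN hβ (by positivity))
  rw [← mul_div_assoc]
  gcongr

/-- At step `j` the support radius is `δ κ^j r` and the modular carries `μ^j`. The choice of `κ`
cancels the growth `2^(jP)` of the step constant, that of `μ` matches the Chebyshev bound with the
volume `κ^(jn)`, and that of `δ` makes the contraction factor exactly `μ`. -/
theorem exists_iteration_constants (n N P : ℕ) (hn : 1 ≤ n) (hP : 1 ≤ P) {s C : ℝ} (hs0 : 0 < s)
    (hC1 : 1 ≤ C) :
    ∃ κ μ δ : ℝ, 0 < κ ∧ 0 < μ ∧ 0 < δ ∧ μ < 1 ∧ δ ≤ 1 ∧ κ ^ s = (1 / 2 : ℝ) ^ P ∧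
      μ = (1 / 2) ^ N * κ ^ n ∧ C * 12 ^ P * δ ^ s = μ := by
  set κ : ℝ := ((1 / 2 : ℝ) ^ P) ^ s⁻¹ with hκ
  have hκ0 : 0 < κ := by positivity
  have hκs : κ ^ s = (1 / 2 : ℝ) ^ P := by
    rw [hκ, ← Real.rpow_mul (by positivity), inv_mul_cancel₀ hs0.ne', Real.rpow_one]
  have hκ1 : κ < 1 := Real.rpow_lt_one (by positivity)
    (pow_lt_one₀ (by norm_num) (by norm_num) (by omega)) (by positivity)
  set μ : ℝ := (1 / 2) ^ N * κ ^ n with hμ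
  have hμ0 : 0 < μ := by positivity
  have hμ1 : μ < 1 := by
    have h1 : (1 / 2 : ℝ) ^ N ≤ 1 := pow_le_one₀ (by norm_num) (by norm_num)
    have h2 : κ ^ n < 1 := pow_lt_one₀ hκ0.le hκ1 (by omega)
    calc μ ≤ 1 * κ ^ n := by rw [hμ]; gcongr
      _ < 1 := by linarith
  refine ⟨κ, μ, (μ / (C * 12 ^ P)) ^ s⁻¹, hκ0, hμ0, by positivity, hμ1, ?_, hκs, rfl, ?_⟩
  · refine Real.rpow_le_one (by positivity) ?_ (by positivity)
    rw [div_le_one (by positivity)]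
    have : (1 : ℝ) ≤ 12 ^ P := one_le_pow₀ (by norm_num)
    nlinarith
  · rw [← Real.rpow_mul (by positivity), inv_mul_cancel₀ hs0.ne', Real.rpow_one]
    field_simp

/-- De Giorgi iteration: a level is an upper bound if it dominates the tail and if the modular of
the positive part is small relative to it. -/
theorem exists_levelModular_threshold (n N : ℕ) (hn : 1 ≤ n) {s lam Lam : ℝ} (hs0 : 0 < s)
    (hs1 : s < 1) (hlam : 0 < lam) (hLam : lam ≤ Lam) :
    ∃ ε : ℝ, 0 < ε ∧ ε ≤ 1 ∧ ∀ (p q : ℝ) (g : ℝ → ℝ), IsGrowthFunction p q g → q ≤ N →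
      ∀ K : Eucl n → Eucl n → ℝ≥0∞, IsKernel lam Lam K →
      ∀ (Ω : Set (Eucl n)) (u : Eucl n → ℝ), IsWeakSubsolution s g K Ω u →
      ∀ (x₀ : Eucl n) (r : ℝ), 0 < r → Metric.ball x₀ r ⊆ Ω → ∀ k : ℝ, 0 < k →
      ∫⁻ y in (Metric.ball x₀ (r / 2))ᶜ,
          ENNReal.ofReal (tailDensity s g (fun x => max (u x) 0) x₀ y) ≤
        ENNReal.ofReal (g (k / r ^ s) / r ^ s) →
      levelModular s g u x₀ r r 0 ≤
        ENNReal.ofReal (ε * primitive g (k / r ^ s)) * volume (Metric.ball x₀ r) →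
      ∀ᵐ x ∂volume.restrict (Metric.ball x₀ (r / 2)), u x ≤ k := by
  have : Nontrivial (Eucl n) := Module.nontrivial_of_finrank_pos (R := ℝ) (by simp; omega)
  obtain ⟨κ, μ, δ, hκ0, hμ0, hδ0, hμ1, hδ1, hκs, hμ, hδs⟩ := exists_iteration_constants n N
    (2 * N + n + 1) hn (by omega) hs0 (stepConst_ge_one n N s hlam hLam)
  -- This value turns the Chebyshev bound at step `j` into exactly half the volume of a ball of
  -- radius `δ κ^j r`; the power of `12` comes from `β = 12 · 2^j`.
  obtain ⟨ε, hε⟩ : ∃ ε : ℝ, ε = δ ^ n * (1 / 2) * (1 / 12) ^ N := ⟨_, rfl⟩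
  have hε0 : 0 < ε := by rw [hε]; positivity
  refine ⟨ε, hε0, ?_, ?_⟩
  · have h1 : δ ^ n ≤ 1 := pow_le_one₀ hδ0.le hδ1
    have h3 : (1 / 12 : ℝ) ^ N ≤ 1 := pow_le_one₀ (by norm_num) (by norm_num)
    rw [hε]
    exact mul_le_one₀ (mul_le_one₀ h1 (by positivity) (by norm_num)) (by positivity) h3
  intro p q g hg hN K hK Ω u hu x₀ r hr hΩ k hk htail hsmall
  have hS0 : 0 < r ^ s := by positivity
  obtain ⟨Gk, hGk⟩ : ∃ Gk, Gk = primitive g (k / r ^ s) := ⟨_, rfl⟩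
  have hGk0 : 0 < Gk := by rw [hGk]; exact hg.primitive_pos (by positivity)
  obtain ⟨V, hV⟩ : ∃ V, V = volume (Metric.ball x₀ r) := ⟨_, rfl⟩
  have hVt : V ≠ ∞ := by rw [hV]; exact measure_ball_lt_top.ne
  rw [← hGk, ← hV] at hsmall
  obtain ⟨R, hR⟩ : ∃ R : ℕ → ℝ, R = fun j => (1 + (1 / 2) ^ j) * r / 2 := ⟨_, rfl⟩
  obtain ⟨l, hl⟩ : ∃ l : ℕ → ℝ, l = fun j => (1 - (1 / 2) ^ j) * k := ⟨_, rfl⟩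
  have hhalf : ∀ j : ℕ, 0 < (1 / 2 : ℝ) ^ j ∧ (1 / 2 : ℝ) ^ j ≤ 1 := fun j =>
    ⟨by positivity, pow_le_one₀ (by norm_num) (by norm_num)⟩
  have htwo : ∀ j : ℕ, (2 : ℝ) ^ j * (1 / 2) ^ j = 1 := fun j => by
    rw [← mul_pow]; norm_num
  -- Geometric decay is carried through the induction itself, because the support condition of each
  -- step rests on the bound from the previous one.
  have hind : ∀ j : ℕ, levelModular s g u x₀ r (R j) (l j) ≤
      ENNReal.ofReal (ε * μ ^ j * Gk) * V := by
    intro j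
    induction j with
    | zero =>
      have e1 : R 0 = r := by simp [hR]; ring
      have e2 : l 0 = 0 := by simp [hl]
      rw [e1, e2, pow_zero, mul_one]
      exact hsmall
    | succ j ih =>
      obtain ⟨hj0, hj1⟩ := hhalf j
      -- One third of `R j - R (j + 1) = 2^(-j) r / 4`. Then `β = r / d = 12 · 2^j`, and the level
      -- gap satisfies `β (l (j + 1) - l j) = 6k`.
      obtain ⟨d, hd⟩ : ∃ d, d = (1 / 2 : ℝ) ^ j * r / 12 := ⟨_, rfl⟩
      have hd0 : 0 < d := by rw [hd]; positivity
      have hRd : R (j + 1) + 3 * d = R j := by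
        simp only [hR, hd, pow_succ]; ring
      obtain ⟨β, hβ⟩ : ∃ β : ℝ, β = 12 * 2 ^ j := ⟨_, rfl⟩
      have hβ1 : 1 ≤ β := by
        have : (1 : ℝ) ≤ 2 ^ j := one_le_pow₀ (by norm_num)
        rw [hβ]
        linarith
      have hβd : β * d = r := by
        calc β * d = (2 ^ j * (1 / 2) ^ j) * r := by rw [hβ, hd]; ring
          _ = r := by rw [htwo, one_mul]
      have hll : k ≤ β * (l (j + 1) - l j) := by
        have : β * (l (j + 1) - l j) = 6 * (2 ^ j * (1 / 2) ^ j) * k := by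
          simp only [hβ, hl, pow_succ]; ring
        rw [this, htwo]; linarith
      obtain ⟨ρ, hρ⟩ : ∃ ρ, ρ = δ * κ ^ j * r := ⟨_, rfl⟩
      have hρ0 : 0 < ρ := by rw [hρ]; positivity
      have hmeas := hg.measure_level_le (s := s) hN hu.1.aemeasurable x₀ hr
        (show R (j + 1) + d ≤ R j by linarith) hk.le hβ1 hll
      rw [← hGk] at hmeas
      have hS : volume (Metric.ball x₀ (R (j + 1) + d) ∩ {x | trunc u (l (j + 1)) x ≠ 0}) ≤
          volume (Metric.ball (0 : Eucl n) ρ) / 2 := by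
        have hG0 : ENNReal.ofReal Gk ≠ 0 := by simpa using hGk0
        refine (ENNReal.mul_le_mul_iff_right hG0 ENNReal.ofReal_ne_top).1 (hmeas.trans ?_)
        refine (mul_le_mul' le_rfl ih).trans ?_
        have e1 : volume (Metric.ball (0 : Eucl n) ρ) / 2 =
            ENNReal.ofReal ((δ * κ ^ j) ^ n / 2) * V := by
          rw [hV, Measure.addHaar_ball _ _ hρ0.le, Measure.addHaar_ball _ x₀ hr.le, hρ, mul_pow,
            ENNReal.ofReal_mul (by positivity), ENNReal.ofReal_div_of_pos two_pos]
          simp only [finrank_euclideanSpace, Fintype.card_fin, ENNReal.ofReal_ofNat, div_eq_mul_inv]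
          ring
        rw [e1, ← mul_assoc, ← mul_assoc, ← ENNReal.ofReal_mul (by positivity),
          ← ENNReal.ofReal_mul hGk0.le]
        refine mul_le_mul' (ENNReal.ofReal_le_ofReal (le_of_eq ?_)) le_rfl
        have e2 : ((2 : ℝ) ^ j) ^ N * ((1 / 2) ^ N) ^ j = 1 := by
          rw [← pow_mul, ← pow_mul, mul_comm N j, htwo]
        have e3 : (12 : ℝ) ^ N * (1 / 12) ^ N = 1 := by rw [← mul_pow]; norm_num
        calc β ^ N * (ε * μ ^ j * Gk)
            = ((12 : ℝ) ^ N * (1 / 12) ^ N) * (((2 : ℝ) ^ j) ^ N * ((1 / 2) ^ N) ^ j) *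
                (Gk * (δ ^ n * (κ ^ n) ^ j * (1 / 2))) := by
              rw [hβ, hε, hμ, mul_pow, mul_pow]
              ring
          _ = Gk * ((δ * κ ^ j) ^ n / 2) := by
              rw [e3, e2, mul_pow, ← pow_mul, ← pow_mul, mul_comm n j]
              ring
      have hlj : 0 ≤ l j := by
        simp only [hl]
        exact mul_nonneg (by linarith) hk.le
      have hstep := hu.levelModular_step hg hN hK hlam hLam hn hs0 hs1 hr hΩ hk htail
        (R := R (j + 1)) (d := d) (h := l j) (l := l (j + 1)) (β := β) (ρ := ρ)
        (by have := (hhalf (j + 1)).1; simp only [hR]; nlinarith) hd0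
        (by rw [hRd]; simp only [hR]; nlinarith) hβ1 hβd.ge
        hlj hll hρ0 hS
      rw [hRd] at hstep
      -- The powers of `2^j` from `β` cancel against `κ^(js)`, so the contraction factor does not
      -- depend on `j`.
      have hfac : stepConst n N s lam Lam * β ^ (2 * N + n + 1) * (ρ / r) ^ s = μ := by
        have e1 : ρ / r = δ * κ ^ j := by rw [hρ]; field_simp
        have e2 : (κ ^ j) ^ s = ((1 / 2 : ℝ) ^ (2 * N + n + 1)) ^ j := by
          rw [← hκs, ← Real.rpow_natCast, ← Real.rpow_mul hκ0.le, mul_comm,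
            Real.rpow_mul hκ0.le, Real.rpow_natCast]
        rw [e1, Real.mul_rpow hδ0.le (by positivity), e2, hβ, mul_pow]
        generalize 2 * N + n + 1 = P at hδs
        have e3 : ((2 : ℝ) ^ j) ^ P * ((1 / 2) ^ P) ^ j = 1 := by
          rw [← pow_mul, ← pow_mul, mul_comm P j, htwo]
        calc stepConst n N s lam Lam * (12 ^ P * (2 ^ j) ^ P) * (δ ^ s * ((1 / 2) ^ P) ^ j)
            = stepConst n N s lam Lam * 12 ^ P * δ ^ s * ((2 ^ j) ^ P * ((1 / 2) ^ P) ^ j) := by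
              ac_rfl
          _ = μ := by rw [e3, hδs, mul_one]
      rw [hfac] at hstep
      refine hstep.trans ((mul_le_mul' le_rfl ih).trans_eq ?_)
      rw [← mul_assoc, ← ENNReal.ofReal_mul hμ0.le, pow_succ]
      congr 2
      ring
  -- The limiting radius `r/2` and level `k` bound every `R j` from below and every `l j` from
  -- above, so this modular lies below all terms of a null sequence.
  have hzero : levelModular s g u x₀ r (r / 2) k = 0 := by
    refine le_antisymm ?_ zero_le
    have hlim : Filter.Tendsto (fun j : ℕ => ENNReal.ofReal (ε * μ ^ j * Gk) * V) Filter.atTop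
        (nhds (ENNReal.ofReal (ε * 0 * Gk) * V)) := by
      refine ENNReal.Tendsto.mul_const (ENNReal.tendsto_ofReal ?_) (Or.inr hVt)
      exact ((tendsto_pow_atTop_nhds_zero_of_lt_one hμ0.le hμ1).const_mul ε).mul_const Gk
    simp only [mul_zero, zero_mul, ENNReal.ofReal_zero] at hlim
    refine ge_of_tendsto' hlim fun j => le_trans ?_ (hind j)
    obtain ⟨hj0, hj1⟩ := hhalf j
    refine hg.levelModular_mono hr u x₀ ?_ ?_
    · simp only [hR]; nlinarith
    · simp only [hl]; nlinarith
  have hGm : AEMeasurable (fun x => ENNReal.ofReal (primitive g (trunc u k x / r ^ s)))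
      (volume.restrict (Metric.ball x₀ (r / 2))) :=
    (hg.aemeasurable_primitive_comp ((aemeasurable_trunc hu.1.aemeasurable k).div_const _)
      fun x => by have := trunc_nonneg u k x; positivity).ennreal_ofReal.restrict
  filter_upwards [(lintegral_eq_zero_iff' hGm).1 hzero] with x hx
  by_contra hcon
  have hpos : 0 < trunc u k x := lt_max_of_lt_left (by linarith)
  have h1 := hg.primitive_pos (t := trunc u k x / r ^ s) (by positivity)
  simp only [Pi.zero_apply, ENNReal.ofReal_eq_zero] at hx
  linarith

end Iteration

end FractionalOrlicz

namespace FractionalOrlicz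

/-! ### From the threshold to the local bound for subsolutions -/

section LocalBound

variable {n : ℕ} {p q lam Lam : ℝ} {g : ℝ → ℝ} {K : Eucl n → Eucl n → ℝ≥0∞}

/-- Off `B_R(x₀)` one has `1 + |x| ≤ M |x - x₀|` with `M = 1 + (1 + |x₀|)/R`, so doubling compares
the two weights. Integrability is what makes the real number `tail` the true value of the integral
rather than the default `0`. -/
theorem MemTailSpace.integrableOn_tailDensity {s : ℝ} {u v : Eucl n → ℝ}
    (hu : MemTailSpace s g u) (hg : IsGrowthFunction p q g) {N : ℕ} (hN : q ≤ N) (hs0 : 0 < s)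
    (hv : AEMeasurable v volume) (hvu : ∀ x, |v x| ≤ |u x|) (x₀ : Eucl n) {R : ℝ} (hR : 0 < R) :
    IntegrableOn (tailDensity s g v x₀) (Metric.ball x₀ R)ᶜ := by
  refine ⟨(hg.aemeasurable_tailDensity s hv x₀).aestronglyMeasurable.restrict, ?_⟩
  set M := 1 + (1 + ‖x₀‖) / R with hM
  have hM1 : 1 ≤ M := le_add_of_nonneg_right (by positivity)
  have hM0 : 0 < M := by linarith
  have hMs : 1 ≤ M ^ s := Real.one_le_rpow hM1 hs0.le
  have hpt : ∀ x ∈ (Metric.ball x₀ R)ᶜ, ‖tailDensity s g v x₀ x‖ₑ ≤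
      ENNReal.ofReal (N * (M ^ s) ^ N * M ^ ((n : ℝ) + s)) *
        ENNReal.ofReal (g (|u x| / (1 + ‖x‖) ^ s) / (1 + ‖x‖) ^ ((n : ℝ) + s)) := by
    intro x hx
    have hxR : R ≤ ‖x - x₀‖ := by
      rw [Set.mem_compl_iff, mem_ball_iff_norm] at hx; exact not_lt.1 hx
    have hd : 0 < ‖x - x₀‖ := hR.trans_le hxR
    have hxM : 1 + ‖x‖ ≤ M * ‖x - x₀‖ := by
      have h1 : ‖x‖ ≤ ‖x - x₀‖ + ‖x₀‖ := norm_le_norm_sub_add _ _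
      have h2 : 1 + ‖x₀‖ ≤ (1 + ‖x₀‖) / R * ‖x - x₀‖ := by
        rw [div_mul_eq_mul_div, le_div_iff₀ hR]; gcongr
      rw [hM, add_mul]; linarith
    have hpow : ∀ a : ℝ, 0 ≤ a → (1 + ‖x‖) ^ a ≤ M ^ a * ‖x - x₀‖ ^ a := fun a ha => by
      rw [← Real.mul_rpow hM0.le hd.le]
      exact Real.rpow_le_rpow (by positivity) hxM ha
    have h1 := hpow s hs0.le
    have h2 := hpow (n + s) (by positivity)
    have hgu := hg.nonneg (t := |u x| / (1 + ‖x‖) ^ s) (by positivity)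
    have hg1 : g (|v x| / ‖x - x₀‖ ^ s) ≤ N * (M ^ s) ^ N * g (|u x| / (1 + ‖x‖) ^ s) := by
      refine le_trans (hg.mono (by positivity) ?_) (hg.map_mul_le_pow hN hMs (by positivity))
      rw [← mul_div_assoc, div_le_div_iff₀ (by positivity) (by positivity)]
      calc |v x| * (1 + ‖x‖) ^ s ≤ |u x| * (M ^ s * ‖x - x₀‖ ^ s) :=
            mul_le_mul (hvu x) h1 (by positivity) (by positivity)
        _ = _ := by ring
    rw [← ofReal_norm, Real.norm_of_nonneg (hg.tailDensity_nonneg _ _ _ _),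
      ← ENNReal.ofReal_mul (by positivity)]
    refine ENNReal.ofReal_le_ofReal ?_
    rw [tailDensity, ← mul_div_assoc, div_le_div_iff₀ (by positivity) (by positivity)]
    calc g (|v x| / ‖x - x₀‖ ^ s) * (1 + ‖x‖) ^ ((n : ℝ) + s)
        ≤ (N * (M ^ s) ^ N * g (|u x| / (1 + ‖x‖) ^ s)) *
            (M ^ ((n : ℝ) + s) * ‖x - x₀‖ ^ ((n : ℝ) + s)) := by gcongr
      _ = _ := by ring
  refine (setLIntegral_mono' Metric.isOpen_ball.measurableSet.compl hpt).trans_lt ?_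
  rw [lintegral_const_mul' _ _ ENNReal.ofReal_ne_top]
  exact ENNReal.mul_lt_top ENNReal.ofReal_lt_top
    ((setLIntegral_le_lintegral _ _).trans_lt hu.lintegral_lt_top)

theorem IsGrowthFunction.tail_nonneg (hg : IsGrowthFunction p q g) (s : ℝ) (v : Eucl n → ℝ)
    (x₀ : Eucl n) (R : ℝ) : 0 ≤ tail s g v x₀ R :=
  integral_nonneg fun x => hg.tailDensity_nonneg s v x₀ x

theorem MemTailSpace.tail_mono {s : ℝ} {u v : Eucl n → ℝ}
    (hu : MemTailSpace s g u) (hg : IsGrowthFunction p q g) {N : ℕ} (hN : q ≤ N) (hs0 : 0 < s)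
    (hv : AEMeasurable v volume) (hvu : ∀ x, |v x| ≤ |u x|) (x₀ : Eucl n) {R : ℝ} (hR : 0 < R) :
    tail s g v x₀ R ≤ tail s g u x₀ R := by
  refine integral_mono (hu.integrableOn_tailDensity hg hN hs0 hv hvu x₀ hR)
    (hu.integrableOn_tailDensity hg hN hs0 hu.aemeasurable (fun _ => le_rfl) x₀ hR) fun x => ?_
  have hvx := hvu x
  have h1 : |v x| / ‖x - x₀‖ ^ s ≤ |u x| / ‖x - x₀‖ ^ s := by gcongr
  have h2 := hg.mono (by positivity) h1
  exact div_le_div_of_nonneg_right h2 (by positivity)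

/-- Doubling removes the factor `r^(-s)`. As for the tail, this makes the average in the estimate a
true average. -/
theorem MemW.integrableOn_modular {s : ℝ} {Ω A : Set (Eucl n)} {u v : Eucl n → ℝ}
    (hu : MemW s g Ω u) (hg : IsGrowthFunction p q g) {N : ℕ} (hN : q ≤ N)
    (hv : AEMeasurable v volume) (hv0 : ∀ x, 0 ≤ v x) (hvu : ∀ x, v x ≤ |u x|) (hA : A ⊆ Ω)
    {r : ℝ} (hr : 0 < r) :
    IntegrableOn (fun x => primitive g (v x / r ^ s)) A := by
  have hS : 0 < r ^ s := by positivity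
  refine ⟨(hg.aemeasurable_primitive_comp (hv.div_const _) fun x => by
    have := hv0 x; positivity).aestronglyMeasurable.restrict, ?_⟩
  set c := max 1 (r ^ s)⁻¹ with hc
  have hc1 : 1 ≤ c := le_max_left _ _
  have hpt : ∀ x, ‖primitive g (v x / r ^ s)‖ₑ ≤
      ENNReal.ofReal (c ^ N) * ENNReal.ofReal (primitive g |u x|) := by
    intro x
    have hvx := hv0 x
    rw [← ofReal_norm, Real.norm_of_nonneg (hg.primitive_nonneg (by positivity)),
      ← ENNReal.ofReal_mul (by positivity)]
    refine ENNReal.ofReal_le_ofReal (le_trans (hg.primitive_mono (by positivity) ?_)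
      (hg.primitive_mul_le_pow hN hc1 (abs_nonneg _)))
    rw [div_eq_inv_mul]
    exact mul_le_mul (le_max_right _ _) (hvu x) hvx (by positivity)
  refine (lintegral_mono hpt).trans_lt ?_
  rw [lintegral_const_mul' _ _ ENNReal.ofReal_ne_top]
  exact ENNReal.mul_lt_top ENNReal.ofReal_lt_top
    ((lintegral_mono_set hA).trans_lt hu.modular_lt_top)

/-- The right-hand side of the local boundedness estimate. -/
noncomputable def localBound (c s : ℝ) (g : ℝ → ℝ) (v : Eucl n → ℝ) (x₀ : Eucl n) (r : ℝ) : ℝ :=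
  c * r ^ s * halfLineInv (primitive g) (⨍ x in Metric.ball x₀ r, primitive g (v x / r ^ s)) +
    r ^ s * halfLineInv g (r ^ s * tail s g v x₀ (r / 2))

theorem IsGrowthFunction.average_nonneg (hg : IsGrowthFunction p q g) {v : Eucl n → ℝ}
    (hv0 : ∀ x, 0 ≤ v x) (x₀ : Eucl n) {r : ℝ} (hr : 0 < r) (s : ℝ) :
    0 ≤ ⨍ x in Metric.ball x₀ r, primitive g (v x / r ^ s) := by
  rw [setAverage_eq, smul_eq_mul]
  refine mul_nonneg (by positivity) (integral_nonneg fun x => hg.primitive_nonneg ?_)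
  have := hv0 x
  positivity

/-- Used with `v = u_+` and `v = (-u)_+`, to replace both one-sided bounds by the one for `|u|`. -/
theorem localBound_mono {s c : ℝ} {Ω : Set (Eucl n)} {u v : Eucl n → ℝ}
    (hu : MemW s g Ω u) (hut : MemTailSpace s g u) (hg : IsGrowthFunction p q g)
    {N : ℕ} (hN : q ≤ N) (hs0 : 0 < s) (hc : 0 ≤ c) (hv : AEMeasurable v volume)
    (hv0 : ∀ x, 0 ≤ v x) (hvu : ∀ x, v x ≤ |u x|) {x₀ : Eucl n} {r : ℝ} (hr : 0 < r)
    (hΩ : Metric.ball x₀ r ⊆ Ω) :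
    localBound c s g v x₀ r ≤ localBound c s g (fun x => |u x|) x₀ r := by
  have hS : 0 < r ^ s := by positivity
  have hua : AEMeasurable (fun x => |u x|) volume :=
    continuous_abs.measurable.comp_aemeasurable hu.aemeasurable
  have hle : ∀ x, |v x| ≤ |u x| := fun x => by rw [abs_of_nonneg (hv0 x)]; exact hvu x
  have htail : tail s g v x₀ (r / 2) ≤ tail s g (fun x => |u x|) x₀ (r / 2) := by
    refine (hut.tail_mono hg hN hs0 hv hle x₀ (by positivity)).trans_eq ?_
    simp [tail]
  have havg : ⨍ x in Metric.ball x₀ r, primitive g (v x / r ^ s) ≤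
      ⨍ x in Metric.ball x₀ r, primitive g (|u x| / r ^ s) := by
    rw [setAverage_eq, setAverage_eq, smul_eq_mul, smul_eq_mul]
    refine mul_le_mul_of_nonneg_left (integral_mono
      (hu.integrableOn_modular hg hN hv hv0 hvu hΩ hr)
      (hu.integrableOn_modular hg hN hua (fun x => abs_nonneg _) (fun x => le_rfl) hΩ hr)
      fun x => hg.primitive_mono ?_ ?_) (by positivity)
    · have := hv0 x; positivity
    · have := hvu x; gcongr
  have h1 := hg.halfLineInv_primitive_mono (hg.average_nonneg hv0 x₀ hr s) havg
  have h2 := hg.halfLineInv_mono (mul_nonneg hS.le (hg.tail_nonneg s v x₀ (r / 2)))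
    (mul_le_mul_of_nonneg_left htail hS.le)
  unfold localBound
  gcongr

/-- Local boundedness from above of weak subsolutions. -/
theorem exists_subsolution_bound (n N : ℕ) (hn : 1 ≤ n) {s lam Lam : ℝ} (hs0 : 0 < s)
    (hs1 : s < 1) (hlam : 0 < lam) (hLam : lam ≤ Lam) :
    ∃ c : ℝ, 0 < c ∧ ∀ (p q : ℝ) (g : ℝ → ℝ), IsGrowthFunction p q g → q ≤ N →
      ∀ K : Eucl n → Eucl n → ℝ≥0∞, IsKernel lam Lam K →
      ∀ (Ω : Set (Eucl n)) (u : Eucl n → ℝ), MemTailSpace s g u → IsWeakSubsolution s g K Ω u →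
      ∀ (x₀ : Eucl n) (r : ℝ), 0 < r → Metric.ball x₀ r ⊆ Ω →
      ∀ᵐ x ∂volume.restrict (Metric.ball x₀ (r / 2)),
        max (u x) 0 ≤ localBound c s g (fun x => max (u x) 0) x₀ r := by
  obtain ⟨ε, hε0, hε1, H⟩ := exists_levelModular_threshold n N hn hs0 hs1 hlam hLam
  -- Since `G(ε⁻¹ a) ≥ ε⁻¹ G(a)`, enlarging the argument by `ε⁻¹` is enough to meet the smallness
  -- threshold `ε`.
  refine ⟨ε⁻¹, by positivity, ?_⟩
  intro p q g hg hN K hK Ω u hut hu x₀ r hr hΩ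
  have hS : 0 < r ^ s := by positivity
  set v : Eucl n → ℝ := fun x => max (u x) 0 with hv
  have hv0 : ∀ x, 0 ≤ v x := fun x => le_max_right _ _
  have hvu : ∀ x, v x ≤ |u x| := fun x => max_le (le_abs_self _) (abs_nonneg _)
  have hvm : AEMeasurable v volume := hu.1.aemeasurable.max aemeasurable_const
  set T := tail s g v x₀ (r / 2) with hT
  have hT0 : 0 ≤ T := hg.tail_nonneg _ _ _ _
  set m := ⨍ x in Metric.ball x₀ r, primitive g (v x / r ^ s) with hm
  have hm0 : 0 ≤ m := hg.average_nonneg hv0 x₀ hr s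
  set a := halfLineInv (primitive g) m with ha
  have ha0 : 0 ≤ a := hg.halfLineInv_primitive_nonneg hm0
  have haG : primitive g a = m := hg.primitive_halfLineInv hm0
  have hST : 0 ≤ r ^ s * T := mul_nonneg hS.le hT0
  set b := halfLineInv g (r ^ s * T) with hb
  have hb0 : 0 ≤ b := hg.halfLineInv_nonneg hST
  have hbg : g b = r ^ s * T := hg.map_halfLineInv hST
  have hε1' : 1 ≤ ε⁻¹ := (one_le_inv₀ hε0).2 hε1
  -- The threshold requires a positive level, while `a` and `b` may both vanish; `τ` is removed at
  -- the end along the sequence `1/(j+1)`.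
  have key : ∀ τ : ℝ, 0 < τ → ∀ᵐ x ∂volume.restrict (Metric.ball x₀ (r / 2)),
      u x ≤ r ^ s * (ε⁻¹ * a + b + τ) := by
    intro τ hτ
    have hdiv : r ^ s * (ε⁻¹ * a + b + τ) / r ^ s = ε⁻¹ * a + b + τ := by field_simp
    have hea : 0 ≤ ε⁻¹ * a := by positivity
    refine H p q g hg hN K hK Ω u hu x₀ r hr hΩ _ (by positivity) ?_ ?_
    · rw [hdiv, ← ofReal_integral_eq_lintegral_ofReal
        (hut.integrableOn_tailDensity hg hN hs0 hvm
          (fun x => by rw [abs_of_nonneg (hv0 x)]; exact hvu x) x₀ (by positivity))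
        (Filter.Eventually.of_forall fun x => hg.tailDensity_nonneg s v x₀ x)]
      refine ENNReal.ofReal_le_ofReal ?_
      -- The summand `b` alone dominates the tail, since `g(b)` equals `r^s` times the tail.
      have h1 : g b ≤ g (ε⁻¹ * a + b + τ) := hg.mono hb0 (by linarith)
      rw [hbg] at h1
      rw [le_div_iff₀ hS, mul_comm]
      exact h1
    · rw [hdiv]
      have hint := hu.1.integrableOn_modular hg hN hvm hv0 hvu hΩ hr
      have e : levelModular s g u x₀ r r 0 =
          ENNReal.ofReal (∫ x in Metric.ball x₀ r, primitive g (v x / r ^ s)) := by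
        rw [ofReal_integral_eq_lintegral_ofReal hint (Filter.Eventually.of_forall fun x =>
          hg.primitive_nonneg (by have := hv0 x; positivity))]
        simp [levelModular, trunc, hv]
      have hVpos : 0 < volume (Metric.ball x₀ r) := Metric.measure_ball_pos _ _ hr
      have hVt : volume (Metric.ball x₀ r) ≠ ∞ := measure_ball_lt_top.ne
      have hVr : 0 < volume.real (Metric.ball x₀ r) := ENNReal.toReal_pos hVpos.ne' hVt
      have e2 : ∫ x in Metric.ball x₀ r, primitive g (v x / r ^ s) =
          m * volume.real (Metric.ball x₀ r) := by
        rw [hm, setAverage_eq, smul_eq_mul]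
        field_simp
      rw [e, e2, ENNReal.ofReal_mul hm0, Measure.real, ENNReal.ofReal_toReal hVt]
      gcongr
      have h1 : ε⁻¹ * primitive g a ≤ primitive g (ε⁻¹ * a + b + τ) :=
        (hg.mul_primitive_le hε1' ha0).trans (hg.primitive_mono hea (by linarith))
      rw [haG, inv_mul_le_iff₀ hε0] at h1
      exact h1
  have hall : ∀ᵐ x ∂volume.restrict (Metric.ball x₀ (r / 2)), ∀ j : ℕ,
      u x ≤ r ^ s * (ε⁻¹ * a + b + 1 / ((j : ℝ) + 1)) :=
    ae_all_iff.2 fun j => key _ (by positivity)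
  filter_upwards [hall] with x hx
  have hlim : Filter.Tendsto (fun j : ℕ => r ^ s * (ε⁻¹ * a + b + 1 / ((j : ℝ) + 1)))
      Filter.atTop (nhds (r ^ s * (ε⁻¹ * a + b + 0))) :=
    (tendsto_one_div_add_atTop_nhds_zero_nat.const_add _).const_mul _
  have h1 := ge_of_tendsto' hlim hx
  have e : localBound ε⁻¹ s g v x₀ r = r ^ s * (ε⁻¹ * a + b + 0) := by
    rw [localBound]; ring
  rw [e]
  exact max_le h1 (by positivity)

theorem IsWeakSolution.isWeakSubsolution {s : ℝ} {Ω : Set (Eucl n)} {u : Eucl n → ℝ}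
    (hu : IsWeakSolution s g K Ω u) : IsWeakSubsolution s g K Ω u :=
  ⟨hu.1, fun η hη _ h => (hu.2 η hη h).le⟩

theorem MemW.neg {s : ℝ} {Ω : Set (Eucl n)} {u : Eucl n → ℝ} (hu : MemW s g Ω u) :
    MemW s g Ω fun x => -u x := by
  refine ⟨hu.aemeasurable.neg, by simpa using hu.modular_lt_top, ?_⟩
  have e : ∀ x y : Eucl n, |-u x - -u y| = |u x - u y| := fun x y => by
    rw [← abs_neg]; ring_nf
  simpa only [e] using hu.gagliardo_lt_top

/-- The integrand of the weak form is odd in `u`. -/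
theorem IsWeakSolution.neg {s : ℝ} {Ω : Set (Eucl n)} {u : Eucl n → ℝ}
    (hu : IsWeakSolution s g K Ω u) : IsWeakSolution s g K Ω fun x => -u x := by
  refine ⟨hu.1.neg, fun η hη h => ?_⟩
  have e : ∀ x y : Eucl n, |-u x - -u y| = |u x - u y| := fun x y => by
    rw [← abs_neg]; ring_nf
  have h0 := hu.2 η hη h
  unfold weakForm at h0 ⊢
  rw [← neg_eq_zero, ← integral_neg] at h0
  rw [← h0]
  refine integral_congr_ae (Filter.Eventually.of_forall fun z => ?_)
  simp only [e]
  ring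

theorem MemTailSpace.neg {s : ℝ} {u : Eucl n → ℝ} (hu : MemTailSpace s g u) :
    MemTailSpace s g fun x => -u x :=
  ⟨hu.aemeasurable.neg, by simpa using hu.lintegral_lt_top⟩

end LocalBound

end FractionalOrlicz

namespace FractionalOrlicz

/-! ### Two-sided bounds for solutions and the main theorem -/

section Solutions

variable {n : ℕ} {p q lam Lam : ℝ} {g : ℝ → ℝ} {K : Eucl n → Eucl n → ℝ≥0∞}

/-- Local boundedness of weak solutions, deduced from the bounds for `u` and `-u`. -/
theorem IsWeakSolution.abs_le_localBound {s c : ℝ} {Ω : Set (Eucl n)} {u : Eucl n → ℝ}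
    (hu : IsWeakSolution s g K Ω u) (hut : MemTailSpace s g u) (hg : IsGrowthFunction p q g)
    {N : ℕ} (hN : q ≤ N) (hs0 : 0 < s) (hc : 0 ≤ c) {x₀ : Eucl n} {r : ℝ} (hr : 0 < r)
    (hΩ : Metric.ball x₀ r ⊆ Ω)
    (H : ∀ v : Eucl n → ℝ, MemTailSpace s g v → IsWeakSubsolution s g K Ω v →
      ∀ᵐ x ∂volume.restrict (Metric.ball x₀ (r / 2)),
        max (v x) 0 ≤ localBound c s g (fun x => max (v x) 0) x₀ r) :
    ∀ᵐ x ∂volume.restrict (Metric.ball x₀ (r / 2)),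
      |u x| ≤ localBound c s g (fun x => |u x|) x₀ r := by
  have hum := hu.1.aemeasurable
  have h1 := localBound_mono hu.1 hut hg hN hs0 hc (hum.max aemeasurable_const)
    (fun x => le_max_right _ _) (fun x => max_le (le_abs_self _) (abs_nonneg _)) hr hΩ
  have h2 := localBound_mono hu.1 hut hg hN hs0 hc (hum.neg.max aemeasurable_const)
    (fun x => le_max_right _ _) (fun x => max_le (neg_le_abs _) (abs_nonneg _)) hr hΩ
  filter_upwards [H u hut hu.isWeakSubsolution, H _ hut.neg hu.neg.isWeakSubsolution] with x hx hx'
  exact abs_le'.2 ⟨(le_max_left _ _).trans (hx.trans h1), (le_max_left _ _).trans (hx'.trans h2)⟩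

theorem memLp_top_of_locally_bounded {Ω A : Set (Eucl n)} {u : Eucl n → ℝ} (hΩ : IsOpen Ω)
    (hum : AEMeasurable u volume) (hA : IsCompact A) (hAΩ : A ⊆ Ω)
    (H : ∀ (x₀ : Eucl n) (r : ℝ), 0 < r → closure (Metric.ball x₀ r) ⊆ Ω →
      ∃ C : ℝ, ∀ᵐ x ∂volume.restrict (Metric.ball x₀ (r / 2)), |u x| ≤ C) :
    MemLp u ∞ (volume.restrict A) := by
  have h : ∃ C : ℝ, ∀ᵐ x ∂volume.restrict A, |u x| ≤ C := by
    -- Essential boundedness passes to subsets and finite unions, so by compactness it suffices to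
    -- have it on a small ball around each point.
    refine hA.induction_on (p := fun A => ∃ C : ℝ, ∀ᵐ x ∂volume.restrict A, |u x| ≤ C)
      ⟨0, by simp⟩ ?_ ?_ ?_
    · rintro A B hAB ⟨C, hC⟩
      exact ⟨C, ae_restrict_of_ae_restrict_of_subset hAB hC⟩
    · rintro A B ⟨C, hC⟩ ⟨D, hD⟩
      refine ⟨max C D, (ae_restrict_union_iff _ _ _).2 ⟨?_, ?_⟩⟩
      · filter_upwards [hC] with x hx using hx.trans (le_max_left _ _)
      · filter_upwards [hD] with x hx using hx.trans (le_max_right _ _)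
    · intro x hx
      obtain ⟨r, hr, hrΩ⟩ := Metric.nhds_basis_closedBall.mem_iff.1 (hΩ.mem_nhds (hAΩ hx))
      exact ⟨Metric.ball x (r / 2), mem_nhdsWithin_of_mem_nhds (Metric.ball_mem_nhds _ (by positivity)),
        H x r hr (Metric.closure_ball_subset_closedBall.trans hrΩ)⟩
  obtain ⟨C, hC⟩ := h
  exact memLp_top_of_bound hum.aestronglyMeasurable.restrict C hC

end Solutions

end FractionalOrlicz

theorem theorem4p3 (n : ℕ) (hn : 2 ≤ n) (s p q lam Lam : ℝ) (hs0 : 0 < s) (hs1 : s < 1)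
    (hp : 1 < p) (hpq : p ≤ q) (hlam : 0 < lam) (hLam : lam ≤ Lam) :
    ∃ c_b : ℝ, 0 < c_b ∧
      ∀ g : ℝ → ℝ, FractionalOrlicz.IsGrowthFunction p q g →
      ∀ K : EuclideanSpace ℝ (Fin n) → EuclideanSpace ℝ (Fin n) → ℝ≥0∞,
        FractionalOrlicz.IsKernel lam Lam K →
      ∀ Ω : Set (EuclideanSpace ℝ (Fin n)), IsOpen Ω → IsConnected Ω → Bornology.IsBounded Ω →
      ∀ u : EuclideanSpace ℝ (Fin n) → ℝ,
        FractionalOrlicz.MemW s g Ω u → FractionalOrlicz.MemTailSpace s g u →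
        (FractionalOrlicz.IsWeakSubsolution s g K Ω u →
          ∀ (x₀ : EuclideanSpace ℝ (Fin n)) (r : ℝ), 0 < r → closure (Metric.ball x₀ r) ⊆ Ω →
            essSup (fun x => ENNReal.ofReal (max (u x) 0))
                (volume.restrict (Metric.ball x₀ (r / 2))) ≤
              ENNReal.ofReal
                (c_b * r ^ s *
                    FractionalOrlicz.halfLineInv (FractionalOrlicz.primitive g)
                      (⨍ x in Metric.ball x₀ r,
                        FractionalOrlicz.primitive g (max (u x) 0 / r ^ s)) +
                  r ^ s *
                    FractionalOrlicz.halfLineInv g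
                      (r ^ s * FractionalOrlicz.tail s g (fun x => max (u x) 0) x₀ (r / 2)))) ∧
        (FractionalOrlicz.IsWeakSolution s g K Ω u →
          (∀ A : Set (EuclideanSpace ℝ (Fin n)), IsCompact A → A ⊆ Ω →
            MemLp u ∞ (volume.restrict A)) ∧
          ∀ (x₀ : EuclideanSpace ℝ (Fin n)) (r : ℝ), 0 < r → closure (Metric.ball x₀ r) ⊆ Ω →
            eLpNorm u ∞ (volume.restrict (Metric.ball x₀ (r / 2))) ≤
              ENNReal.ofReal
                (c_b * r ^ s *
                    FractionalOrlicz.halfLineInv (FractionalOrlicz.primitive g)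
                      (⨍ x in Metric.ball x₀ r, FractionalOrlicz.primitive g (|u x| / r ^ s)) +
                  r ^ s *
                    FractionalOrlicz.halfLineInv g
                      (r ^ s * FractionalOrlicz.tail s g u x₀ (r / 2)))) := by
  -- Rounding `q` up gives the natural exponent `N`, so `c` is fixed before `g`, `K`, `Ω` and `u`
  -- are chosen.
  obtain ⟨c, hc, H⟩ := FractionalOrlicz.exists_subsolution_bound n ⌈q⌉₊ (by omega) hs0 hs1 hlam hLam
  refine ⟨c, hc, fun g hg K hK Ω hΩ _ _ u _ hut => ⟨fun hu x₀ r hr hB => ?_, fun hu => ?_⟩⟩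
  · refine essSup_le_of_ae_le _ ?_
    filter_upwards [H p q g hg (Nat.le_ceil q) K hK Ω u hut hu x₀ r hr
      (subset_closure.trans hB)] with x hx
    exact ENNReal.ofReal_le_ofReal hx
  have key : ∀ (x₀ : EuclideanSpace ℝ (Fin n)) (r : ℝ), 0 < r → closure (Metric.ball x₀ r) ⊆ Ω →
      ∀ᵐ x ∂volume.restrict (Metric.ball x₀ (r / 2)),
        |u x| ≤ FractionalOrlicz.localBound c s g (fun x => |u x|) x₀ r := fun x₀ r hr hB =>
    hu.abs_le_localBound hut hg (Nat.le_ceil q) hs0 hc.le hr (subset_closure.trans hB)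
      fun v hvt hv => H p q g hg (Nat.le_ceil q) K hK Ω v hvt hv x₀ r hr (subset_closure.trans hB)
  refine ⟨fun A hA hAΩ => FractionalOrlicz.memLp_top_of_locally_bounded hΩ hut.aemeasurable hA hAΩ
    fun x₀ r hr hB => ⟨_, key x₀ r hr hB⟩, fun x₀ r hr hB => ?_⟩
  rw [eLpNorm_exponent_top]
  refine eLpNormEssSup_le_of_ae_bound ?_
  filter_upwards [key x₀ r hr hB] with x hx
  -- The tail depends on its function only through the absolute value, so the tails of `|u|` and `u`
  -- agree.
  simpa only [FractionalOrlicz.localBound, FractionalOrlicz.tail, abs_abs, Real.norm_eq_abs] using hx
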